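/- Let $0<a<b<\infty$ and $-1<q_0\le q_1<\infty$, and let $q:(0,\infty)\to[q_0,q_1]$ be a continuous function that vanishes outside $[a,b]$. Let $n\ge 0$ be an integer and let $H_n=J_n+iY_n$ be the Hankel function of order $n$. Then: (i) For every $k\in\mathbb{C}$ with $\operatorname{Im}k>0$ there is exactly one twice differentiable function $\psi_n(\cdot,k):(0,\infty)\to\mathbb{C}$ such that $$\psi_n''(r,k)+k^2\bigl(1+q(r)\bigr)\psi_n(r,k)-\frac{n^2-\frac14}{r^2}\,\psi_n(r,k)=0\quad (r>0),\qquad \psi_n(r,k)=\sqrt{r}\,H_n(kr)\quad (r\ge b),$$ where $'$ denotes $\partial/\partial r$. (ii) For all $r>0$ and all $k$ with $\operatorname{Im}k>0$ one has $\psi_n(r,k)\neq0$, so that the impedance $$\phi_n(r,k)=\frac{\psi_n'(r,k)}{i\,k\,\psi_n(r,k)}$$ is well defined; and for every $r>0$ the function $k\mapsto\phi_n(r,k)$ is analytic on the upper half-plane $\{k\in\mathbb{C}:\operatorname{Im}k>0\}$. -/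

import Mathlib

open Complex Set

noncomputable section

/-- The logarithm whose branch cut is the negative imaginary axis, so that `arg` lies in
`(-π/2, 3π/2]`; it is the usual real logarithm on the positive reals. -/
def logNegImCut (z : ℂ) : ℂ :=
  Complex.log (-I * z) + I * (Real.pi / 2)

/-- The Bessel function of the first kind `J_n` of integer order `n ≥ 0`. -/
def besselJ (n : ℕ) (z : ℂ) : ℂ :=
  (z / 2) ^ n * ∑' m : ℕ, (-(z ^ 2 / 4)) ^ m / ((m.factorial : ℂ) * ((n + m).factorial : ℂ))

/-- The Bessel function of the second kind `Y_n` of integer order `n ≥ 0`; here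
`Complex.digamma` is `Γ' / Γ`. -/
def besselY (n : ℕ) (z : ℂ) : ℂ :=
  -(((z / 2) ^ n)⁻¹ / Real.pi) *
      ∑ m ∈ Finset.range n, ((n - m - 1).factorial : ℂ) / (m.factorial : ℂ) * (z ^ 2 / 4) ^ m
    + 2 / Real.pi * logNegImCut (z / 2) * besselJ n z
    - (z / 2) ^ n / Real.pi *
      ∑' m : ℕ, (Complex.digamma (m + 1) + Complex.digamma (n + m + 1)) *
        ((-(z ^ 2 / 4)) ^ m / ((m.factorial : ℂ) * ((n + m).factorial : ℂ)))

/-- The (first) Hankel function `H_n = J_n + i Y_n`. -/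
def hankelH (n : ℕ) (z : ℂ) : ℂ :=
  besselJ n z + I * besselY n z

/-- `ψ` is the rescaled radial field `ψ_n(·, k)` on `(0, ∞)` for a potential `q` that vanishes
beyond radius `b`: a twice differentiable solution of
`ψ'' + k² (1 + q) ψ - (n² - 1/4) / r² ψ = 0` on `(0, ∞)` which equals `√r H_n(k r)` for `r ≥ b`. -/
structure IsRadialField (q : ℝ → ℝ) (b : ℝ) (n : ℕ) (k : ℂ) (ψ : ℝ → ℂ) : Prop where
  differentiableAt : ∀ r : ℝ, 0 < r → DifferentiableAt ℝ ψ r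
  differentiableAt_deriv : ∀ r : ℝ, 0 < r → DifferentiableAt ℝ (deriv ψ) r
  ode : ∀ r : ℝ, 0 < r →
    deriv (deriv ψ) r + k ^ 2 * (1 + (q r : ℂ)) * ψ r
      - ((n : ℂ) ^ 2 - 1 / 4) / (r : ℂ) ^ 2 * ψ r = 0
  outgoing : ∀ r : ℝ, b ≤ r → ψ r = (Real.sqrt r : ℂ) * hankelH n (k * (r : ℂ))

/-- The impedance `φ(r, k) = ψ'(r) / (i k ψ(r))` of a field `ψ` at frequency `k`. -/
def impedance (ψ : ℝ → ℂ) (r : ℝ) (k : ℂ) : ℂ :=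
  deriv ψ r / (I * k * ψ r)

end

noncomputable section

open MeasureTheory Filter Topology ComplexConjugate

/-! Existence and uniqueness are linear ODE theory: beyond `b` the field is the free field, so its
Cauchy data there are known, and the equation, which is regular on `(0, ∞)`, is solved inwards from
them. The data are holomorphic in `k` and the equation contains `k` only through `k ^ 2`. A Volterra
operator in an exponentially weighted form is a contraction, uniformly for bounded `k ^ 2`, so its
Neumann inverse carries holomorphy to `ψ` and `ψ'` at every radius (`exists_linear_ode_solution`,
`differentiableAt_field`).

The heart is the absence of zeros. With `ψ = √r u`, the flux `F = Re (i k̄ r u' ū)` satisfies `F' =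
Im k (r |u'|² + (n²/r² + |k|² (1 + q)) r |u|²)`, which is nonnegative because `q > -1`. If `ψ(r₀) =
0` then `F(r₀) = 0`. Since `F` increases and tends to `0` at infinity, it vanishes on `[r₀, ∞)`;
then so does `F'`, hence `ψ`, and `H_n` would vanish on the end of a ray, which is impossible
(`IsFieldSystem.fst_ne_zero`).

The limit of `F` at infinity needs exponential decay of `H_n`, invisible in its series. For order
zero it is read off `H_0(z) = -(2i/π) ∫₀^∞ exp(i z cosh t) dt`. Both sides solve Bessel's equation,
and their expansions at the origin agree, including the constant `γ`. A Wronskian with `J_0` then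
makes the difference vanish (`hankelDiff_eq_zero`). The ladder relation gives order one, and the
three-term recurrence all the others (`exists_norm_hankelH_le`). -/

/-! ### Power series in the Hankel function and their contiguity relations. -/

theorem HasSum.of_eq {f g : ℕ → ℂ} {a b : ℂ} (h : HasSum f a) (hfg : ∀ m, g m = f m)
    (hab : b = a) : HasSum g b := by
  rw [hab, funext hfg]; exact h

/-- Entire power series whose coefficients are `O(2 ^ m / m!)` can be differentiated termwise. -/
theorem exists_hasDerivAt_powerSeries {c : ℕ → ℂ} {D : ℝ}
    (hc : ∀ m, ‖c m‖ ≤ D * (2 ^ m / (m.factorial : ℝ))) (s : ℂ) :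
    HasSum (fun m => c m * s ^ m) (∑' m, c m * s ^ m) ∧
    ∃ f' : ℂ, HasDerivAt (fun s => ∑' m, c m * s ^ m) f' s ∧
      HasSum (fun m : ℕ => ((m : ℂ) + 1) * c (m + 1) * s ^ m) f' ∧
      HasSum (fun m : ℕ => (m : ℂ) * c m * s ^ m) (s * f') := by
  have hD : 0 ≤ D := by simpa using (norm_nonneg _).trans (hc 0)
  have hsum : ∀ z : ℂ, Summable fun m => c m * z ^ m := by
    intro z
    refine Summable.of_norm_bounded
      ((Real.summable_pow_div_factorial (2 * ‖z‖)).mul_left D) fun m => ?_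
    rw [norm_mul, norm_pow]
    calc ‖c m‖ * ‖z‖ ^ m ≤ D * (2 ^ m / (m.factorial : ℝ)) * ‖z‖ ^ m := by gcongr; exact hc m
      _ = _ := by rw [mul_pow]; ring
  set R : ℝ := ‖s‖ + 1
  have hR : 1 ≤ R := by simp [R]
  -- In `4 * R` one factor 2 comes from the coefficients and one from `m ≤ 2 ^ m`; `R` bounds `‖y‖`.
  have hbd : ∀ (m : ℕ) (y : ℂ), y ∈ Metric.ball (0 : ℂ) R →
      ‖c m * ((m : ℂ) * y ^ (m - 1))‖ ≤ D * ((4 * R) ^ m / (m.factorial : ℝ)) := by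
    intro m y hy
    have hy' : ‖y‖ ≤ R := by simpa using (mem_ball_zero_iff.1 hy).le
    have h1 : ‖y‖ ^ (m - 1) ≤ R ^ m :=
      (pow_le_pow_left₀ (norm_nonneg _) hy' _).trans (pow_le_pow_right₀ hR (by omega))
    have h2 : (m : ℝ) ≤ 2 ^ m := by exact_mod_cast (Nat.lt_two_pow_self).le
    rw [norm_mul, norm_mul, norm_pow, Complex.norm_natCast]
    calc ‖c m‖ * (m * ‖y‖ ^ (m - 1))
        ≤ D * (2 ^ m / (m.factorial : ℝ)) * (2 ^ m * R ^ m) := by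
          gcongr; exact hc m
      _ = _ := by rw [mul_pow, show (4 : ℝ) = 2 * 2 by norm_num, mul_pow]; ring
  have hder : HasDerivAt (fun s => ∑' m, c m * s ^ m)
      (∑' m : ℕ, c m * ((m : ℂ) * s ^ (m - 1))) s := by
    refine hasDerivAt_tsum_of_isPreconnected
      ((Real.summable_pow_div_factorial (4 * R)).mul_left D) Metric.isOpen_ball
      (convex_ball (0 : ℂ) R).isPreconnected
      (fun m y _ => (hasDerivAt_pow m y).const_mul (c m)) hbd (y₀ := s) ?_ (hsum s) ?_ <;>
    simp [R]
  have hsm : Summable fun m : ℕ => c m * ((m : ℂ) * s ^ (m - 1)) :=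
    Summable.of_norm_bounded ((Real.summable_pow_div_factorial (4 * R)).mul_left D)
      fun m => hbd m s (by simp [R])
  refine ⟨(hsum s).hasSum, _, hder, ?_, ?_⟩
  · have := (hasSum_nat_add_iff' 1).2 hsm.hasSum
    simp only [Finset.range_one, Finset.sum_singleton, Nat.cast_zero, zero_mul, mul_zero,
      sub_zero] at this
    refine this.of_eq (fun m => ?_) rfl
    push_cast
    ring
  · refine (hsm.hasSum.mul_left s).of_eq (fun m => ?_) rfl
    rcases m with _ | m
    · simp
    · rw [Nat.add_sub_cancel]; ring

/-- The entire function `∑ (-s)^m / (m! (n+m)!)`, so that `J_n(z) = (z/2)^n besA n (z²/4)`. -/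
def besA (n : ℕ) (s : ℂ) : ℂ :=
  ∑' m : ℕ, (-s) ^ m / ((m.factorial : ℂ) * ((n + m).factorial : ℂ))

/-- The entire function in the last term of `Y_n`. -/
def besB (n : ℕ) (s : ℂ) : ℂ :=
  ∑' m : ℕ, (Complex.digamma (m + 1) + Complex.digamma (n + m + 1)) *
    ((-s) ^ m / ((m.factorial : ℂ) * ((n + m).factorial : ℂ)))

/-- The polynomial in the first term of `Y_n`. -/
def besP (n : ℕ) (s : ℂ) : ℂ :=
  ∑ m ∈ Finset.range n, ((n - m - 1).factorial : ℂ) / (m.factorial : ℂ) * s ^ m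

/-- Coefficients of `besA`. -/
def coeffA (n m : ℕ) : ℂ := (-1) ^ m / ((m.factorial : ℂ) * ((n + m).factorial : ℂ))

/-- Coefficients of `besB`. -/
def coeffB (n m : ℕ) : ℂ :=
  (Complex.digamma (m + 1) + Complex.digamma (n + m + 1)) * coeffA n m

theorem besA_eq_tsum (n : ℕ) : besA n = fun s => ∑' m, coeffA n m * s ^ m := by
  funext s
  refine tsum_congr fun m => ?_
  rw [coeffA, neg_pow]; ring

theorem besB_eq_tsum (n : ℕ) : besB n = fun s => ∑' m, coeffB n m * s ^ m := by
  funext s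
  refine tsum_congr fun m => ?_
  rw [coeffB, coeffA, neg_pow]; ring

theorem digamma_nat_succ (m : ℕ) :
    Complex.digamma ((m : ℂ) + 1 + 1) = Complex.digamma ((m : ℂ) + 1) + ((m : ℂ) + 1)⁻¹ := by
  refine Complex.digamma_apply_add_one _ fun j h => ?_
  have : ((m + 1 + j : ℕ) : ℂ) = 0 := by push_cast; rw [h]; ring
  exact absurd (Nat.cast_eq_zero.1 this) (by omega)

/-- Crude linear growth is enough, since `m ≤ 2 ^ m` brings `coeffB` under the bound of
`exists_hasDerivAt_powerSeries`. -/
theorem norm_digamma_nat_le (m : ℕ) :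
    ‖Complex.digamma ((m : ℂ) + 1)‖ ≤ ‖Complex.digamma 1‖ + m := by
  induction m with
  | zero => simp
  | succ m ih =>
    push_cast
    rw [digamma_nat_succ]
    have h : ‖((m : ℂ) + 1)⁻¹‖ ≤ 1 := by
      rw [norm_inv]
      refine inv_le_one_of_one_le₀ ?_
      have : ‖((m + 1 : ℕ) : ℂ)‖ = ((m + 1 : ℕ) : ℝ) := Complex.norm_natCast _
      push_cast at this
      rw [this]
      linarith [(Nat.cast_nonneg m : (0 : ℝ) ≤ m)]
    linarith [norm_add_le (Complex.digamma ((m : ℂ) + 1)) ((m : ℂ) + 1)⁻¹]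

theorem norm_coeffA_le (n m : ℕ) : ‖coeffA n m‖ ≤ 1 / (m.factorial : ℝ) := by
  rw [coeffA, norm_div, norm_mul, norm_pow, norm_neg, norm_one, one_pow, Complex.norm_natCast,
    Complex.norm_natCast]
  have h1 : (0 : ℝ) < m.factorial := by exact_mod_cast m.factorial_pos
  have h2 : (1 : ℝ) ≤ (n + m).factorial := by exact_mod_cast (n + m).factorial_pos
  refine one_div_le_one_div_of_le h1 ?_
  nlinarith

theorem norm_coeffA_le' (n m : ℕ) : ‖coeffA n m‖ ≤ 1 * (2 ^ m / (m.factorial : ℝ)) := by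
  refine (norm_coeffA_le n m).trans ?_
  rw [one_mul]
  gcongr
  exact one_le_pow₀ (by norm_num)

theorem norm_coeffB_le (n m : ℕ) :
    ‖coeffB n m‖ ≤ (2 * ‖Complex.digamma 1‖ + n + 2) * (2 ^ m / (m.factorial : ℝ)) := by
  have h1 := norm_digamma_nat_le m
  have h2 := norm_digamma_nat_le (n + m)
  push_cast at h2
  have hm : (m : ℝ) ≤ 2 ^ m := by exact_mod_cast (Nat.lt_two_pow_self).le
  have h1m : (1 : ℝ) ≤ 2 ^ m := one_le_pow₀ (by norm_num)
  have h3 : ‖Complex.digamma ((m : ℂ) + 1) + Complex.digamma ((n : ℂ) + m + 1)‖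
      ≤ (2 * ‖Complex.digamma 1‖ + n + 2) * 2 ^ m := by
    refine (norm_add_le _ _).trans ?_
    have : (2 * ‖Complex.digamma 1‖ + n) * 1 ≤ (2 * ‖Complex.digamma 1‖ + n) * 2 ^ m := by
      gcongr
    linarith
  rw [coeffB, norm_mul]
  calc _ ≤ (2 * ‖Complex.digamma 1‖ + n + 2) * 2 ^ m * (1 / (m.factorial : ℝ)) := by
        gcongr; exact norm_coeffA_le n m
    _ = _ := by ring

theorem coeffA_succ_right (n m : ℕ) : ((m : ℂ) + 1) * coeffA n (m + 1) = -coeffA (n + 1) m := by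
  have h : (n + (m + 1)) = n + 1 + m := by omega
  have h1 : ((m : ℂ) + 1) ≠ 0 := Nat.cast_add_one_ne_zero m
  have h2 : (m.factorial : ℂ) ≠ 0 := Nat.cast_ne_zero.2 m.factorial_ne_zero
  have h3 : ((n + 1 + m).factorial : ℂ) ≠ 0 := Nat.cast_ne_zero.2 (Nat.factorial_ne_zero _)
  rw [coeffA, coeffA, h, Nat.factorial_succ m, pow_succ]
  push_cast
  field_simp

theorem coeffA_succ_left (n m : ℕ) :
    ((n : ℂ) + 1 + m) * coeffA (n + 1) m = coeffA n m := by
  have h : n + 1 + m = (n + m) + 1 := by omega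
  have h1 : ((n : ℂ) + m + 1) ≠ 0 := by
    have := Nat.cast_add_one_ne_zero (R := ℂ) (n + m)
    push_cast at this; exact this
  have h2 : (m.factorial : ℂ) ≠ 0 := Nat.cast_ne_zero.2 m.factorial_ne_zero
  have h3 : ((n + m).factorial : ℂ) ≠ 0 := Nat.cast_ne_zero.2 (Nat.factorial_ne_zero _)
  rw [coeffA, coeffA, h, Nat.factorial_succ]
  push_cast
  field_simp
  ring

/-- The recurrence of the digamma function adds a `coeffA` term to the relation for `coeffA`; in
`H_n` this term is cancelled by the derivative of the logarithm. -/
theorem coeffB_succ_right (n m : ℕ) :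
    ((m : ℂ) + 1) * coeffB n (m + 1) = -coeffB (n + 1) m + coeffA n (m + 1) := by
  have h1 : ((m : ℂ) + 1) ≠ 0 := Nat.cast_add_one_ne_zero m
  have e1 : ((m : ℂ) + 1) * coeffB n (m + 1) =
      (Complex.digamma (m + 1) + Complex.digamma (n + m + 1 + 1) + ((m : ℂ) + 1)⁻¹)
        * (((m : ℂ) + 1) * coeffA n (m + 1)) := by
    rw [coeffB]
    push_cast
    rw [digamma_nat_succ, ← add_assoc (n : ℂ) m 1]
    ring
  have e2 : coeffB (n + 1) m =
      (Complex.digamma (m + 1) + Complex.digamma (n + m + 1 + 1)) * coeffA (n + 1) m := by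
    rw [coeffB]; push_cast; ring_nf
  have e3 : coeffA n (m + 1) = -(((m : ℂ) + 1)⁻¹ * coeffA (n + 1) m) := by
    have := coeffA_succ_right n m
    field_simp
    linear_combination this
  rw [e1, coeffA_succ_right, e2, e3]
  ring

theorem coeffB_succ_left (n m : ℕ) :
    ((n : ℂ) + 1 + m) * coeffB (n + 1) m = coeffB n m + coeffA (n + 1) m := by
  have h1 : ((n : ℂ) + m + 1) ≠ 0 := by
    have := Nat.cast_add_one_ne_zero (R := ℂ) (n + m)
    push_cast at this; exact this
  have hd := digamma_nat_succ (n + m)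
  push_cast at hd
  have hA := coeffA_succ_left n m
  rw [coeffB, coeffB, ← hA]
  push_cast
  rw [show (n : ℂ) + 1 + m + 1 = n + m + 1 + 1 by ring, hd]
  field_simp
  ring

theorem hasSum_besA (n : ℕ) (s : ℂ) : HasSum (fun m => coeffA n m * s ^ m) (besA n s) := by
  rw [besA_eq_tsum]
  exact (exists_hasDerivAt_powerSeries (norm_coeffA_le' n) s).1

theorem hasSum_besB (n : ℕ) (s : ℂ) : HasSum (fun m => coeffB n m * s ^ m) (besB n s) := by
  rw [besB_eq_tsum]
  exact (exists_hasDerivAt_powerSeries (norm_coeffB_le n) s).1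

theorem hasDerivAt_besA (n : ℕ) (s : ℂ) : HasDerivAt (besA n) (-besA (n + 1) s) s := by
  obtain ⟨-, f', h, h1, -⟩ := exists_hasDerivAt_powerSeries (norm_coeffA_le' n) s
  rw [← besA_eq_tsum] at h
  convert h using 1
  refine (hasSum_besA (n + 1) s).neg.unique (h1.of_eq (fun m => ?_) rfl)
  rw [coeffA_succ_right]; ring

theorem besA_recurrence (n : ℕ) (s : ℂ) :
    ((n : ℂ) + 1) * besA (n + 1) s - s * besA (n + 2) s = besA n s := by
  obtain ⟨-, f', h, -, h2⟩ := exists_hasDerivAt_powerSeries (norm_coeffA_le' (n + 1)) s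
  rw [← besA_eq_tsum] at h
  have hf : f' = -besA (n + 2) s := h.unique (hasDerivAt_besA (n + 1) s)
  have := ((hasSum_besA (n + 1) s).mul_left ((n : ℂ) + 1)).add h2
  have h3 : HasSum (fun m => coeffA n m * s ^ m)
      (((n : ℂ) + 1) * besA (n + 1) s + s * f') := by
    refine this.of_eq (fun m => ?_) rfl
    rw [← coeffA_succ_left]; ring
  rw [(hasSum_besA n s).unique h3, hf]; ring

/-- The derivative of `besB`, multiplied by the variable. -/
theorem exists_hasDerivAt_besB (n : ℕ) (s : ℂ) :
    ∃ f' : ℂ, HasDerivAt (besB n) f' s ∧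
      s * f' = -(s * besB (n + 1) s) - 1 / (n.factorial : ℂ) + besA n s := by
  obtain ⟨-, f', h, h1, -⟩ := exists_hasDerivAt_powerSeries (norm_coeffB_le n) s
  rw [← besB_eq_tsum] at h
  refine ⟨f', h, (h1.mul_left s).unique ?_⟩
  -- The shifted series lacks the term `m = 0` of `besA`, which is `1 / n!`.
  have hA := (hasSum_nat_add_iff' 1).2 (hasSum_besA n s)
  have hB := ((hasSum_besB (n + 1) s).mul_left s).neg.add hA
  refine hB.of_eq (fun m => ?_) ?_
  · linear_combination s ^ (m + 1) * coeffB_succ_right n m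
  · simp [coeffA]; ring

theorem hasDerivAt_besB_succ (n : ℕ) (s : ℂ) {f' : ℂ} (h : HasDerivAt (besB (n + 1)) f' s) :
    ((n : ℂ) + 1) * besB (n + 1) s + s * f' = besB n s + besA (n + 1) s := by
  obtain ⟨-, f'', h', -, h2⟩ := exists_hasDerivAt_powerSeries (norm_coeffB_le (n + 1)) s
  rw [← besB_eq_tsum] at h'
  rw [h.unique h']
  refine (((hasSum_besB (n + 1) s).mul_left ((n : ℂ) + 1)).add h2).unique ?_
  refine ((hasSum_besB n s).add (hasSum_besA (n + 1) s)).of_eq (fun m => ?_) rfl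
  have := coeffB_succ_left n m
  linear_combination s ^ m * this

theorem hasDerivAt_besP_succ (n : ℕ) (s : ℂ) : HasDerivAt (besP (n + 1)) (besP n s) s := by
  have h := HasDerivAt.fun_sum (u := Finset.range (n + 1))
    (A := fun m s => ((n + 1 - m - 1).factorial : ℂ) / (m.factorial : ℂ) * s ^ m)
    (A' := fun m => ((n + 1 - m - 1).factorial : ℂ) / (m.factorial : ℂ) * ((m : ℂ) * s ^ (m - 1)))
    (x := s) fun m _ => (hasDerivAt_pow m s).const_mul _
  refine h.congr_deriv ?_
  rw [Finset.sum_range_succ']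
  simp only [Nat.cast_zero, zero_mul, mul_zero, add_zero, besP]
  refine Finset.sum_congr rfl fun m hm => ?_
  rw [show n + 1 - (m + 1) - 1 = n - m - 1 by omega, Nat.add_sub_cancel, Nat.factorial_succ]
  have h1 : ((m : ℂ) + 1) ≠ 0 := Nat.cast_add_one_ne_zero m
  have h2 : (m.factorial : ℂ) ≠ 0 := Nat.cast_ne_zero.2 m.factorial_ne_zero
  push_cast
  field_simp

/-- `besP (n + 1)` has one more term than `besP n`, namely `s ^ n / n!`. It compensates the `1 / n!`
in `exists_hasDerivAt_besB`. -/
theorem exists_hasDerivAt_besP (n : ℕ) (s : ℂ) :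
    ∃ f' : ℂ, HasDerivAt (besP n) f' s ∧
      n * besP n s - s * f' = besP (n + 1) s - s ^ n / (n.factorial : ℂ) := by
  have h := HasDerivAt.fun_sum (u := Finset.range n)
    (A := fun m s => ((n - m - 1).factorial : ℂ) / (m.factorial : ℂ) * s ^ m)
    (A' := fun m => ((n - m - 1).factorial : ℂ) / (m.factorial : ℂ) * ((m : ℂ) * s ^ (m - 1)))
    (x := s) fun m _ => (hasDerivAt_pow m s).const_mul _
  refine ⟨_, h, ?_⟩
  rw [besP, besP, Finset.sum_range_succ, Finset.mul_sum, Finset.mul_sum,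
    ← Finset.sum_sub_distrib]
  simp only [add_tsub_cancel_left, Nat.sub_self, Nat.factorial_zero, Nat.cast_one]
  rw [show 1 / (n.factorial : ℂ) * s ^ n = s ^ n / (n.factorial : ℂ) by ring, add_sub_cancel_right]
  refine Finset.sum_congr rfl fun m hm => ?_
  have hmn : m < n := Finset.mem_range.1 hm
  obtain ⟨j, rfl⟩ := Nat.exists_eq_add_of_lt hmn
  rw [show m + j + 1 - m - 1 = j by omega, show m + j + 1 + 1 - m - 1 = j + 1 by omega,
    Nat.factorial_succ]
  rcases m with _ | m
  · simp
  · rw [Nat.add_sub_cancel]; push_cast; ring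

/-! ### Ladder relations and the three-term recurrence for the Hankel functions. -/

theorem hankelH_eq (n : ℕ) (z : ℂ) :
    hankelH n z = (z / 2) ^ n * ((1 + 2 * I / Real.pi * logNegImCut (z / 2)) * besA n (z ^ 2 / 4)
      - I / Real.pi * besB n (z ^ 2 / 4)) - I / Real.pi * (((z / 2) ^ n)⁻¹ * besP n (z ^ 2 / 4)) := by
  rw [hankelH, besselY, besselJ, besA, besB, besP]
  ring

theorem hasDerivAt_logNegImCut_half {z : ℂ} (hz : 0 < z.im) :
    HasDerivAt (fun z => logNegImCut (z / 2)) (1 / z) z := by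
  have hz0 : z ≠ 0 := by rintro rfl; simp at hz
  have hs : -I * (z / 2) ∈ slitPlane := by
    left
    have : (-I * (z / 2)).re = z.im / 2 := by simp
    rw [this]; linarith
  have h := ((((hasDerivAt_id z).div_const 2).const_mul (-I)).clog hs).add_const
    (I * (Real.pi / 2 : ℂ))
  refine h.congr_deriv ?_
  simp only [id]
  field_simp [I_ne_zero]

/-- Ladder relation `(z^{-n} H_n)' = -z^{-n} H_{n+1}`. -/
theorem hasDerivAt_hankelH (n : ℕ) {z : ℂ} (hz : 0 < z.im) :
    HasDerivAt (hankelH n) (n / z * hankelH n z - hankelH (n + 1) z) z := by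
  have hz0 : z ≠ 0 := by rintro rfl; simp at hz
  obtain ⟨b', hb, eB⟩ := exists_hasDerivAt_besB n (z ^ 2 / 4)
  obtain ⟨p', hp, eP⟩ := exists_hasDerivAt_besP n (z ^ 2 / 4)
  have hs : HasDerivAt (fun z : ℂ => z ^ 2 / 4) (z / 2) z :=
    ((hasDerivAt_pow 2 z).div_const 4).congr_deriv (by push_cast; ring)
  have hw : HasDerivAt (fun z : ℂ => (z / 2) ^ n) (n * (z / 2) ^ n / z) z := by
    refine (((hasDerivAt_id z).div_const 2).pow n).congr_deriv ?_
    rcases n with _ | n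
    · simp
    · simp only [id, Nat.add_sub_cancel, pow_succ]; field_simp
  have hW : (z / 2) ^ n ≠ 0 := pow_ne_zero _ (div_ne_zero hz0 two_ne_zero)
  have hA := (hasDerivAt_besA n (z ^ 2 / 4)).comp z hs
  have hB := hb.comp z hs
  have hP := hp.comp z hs
  have h1 := (((hasDerivAt_logNegImCut_half hz).const_mul (2 * I / Real.pi : ℂ)).const_add 1).mul hA
  have h := (hw.mul (h1.sub (hB.const_mul (I / Real.pi : ℂ)))).sub
    (((hw.inv hW).mul hP).const_mul (I / Real.pi : ℂ))
  rw [show hankelH n = _ from funext (hankelH_eq n)]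
  refine h.congr_deriv ?_
  rw [hankelH_eq]
  have hpi : (Real.pi : ℂ) ≠ 0 := by exact_mod_cast Real.pi_ne_zero
  have hf : (n.factorial : ℂ) ≠ 0 := Nat.cast_ne_zero.2 n.factorial_ne_zero
  -- The polynomial part carries the factor `((z / 2) ^ n)⁻¹` and the series `(z / 2) ^ n`, so this
  -- identity lets their `1 / n!` remainders cancel.
  have hsn : (z ^ 2 / 4) ^ n = (z / 2) ^ n * (z / 2) ^ n := by
    rw [← mul_pow]; congr 1; ring
  rw [hsn] at eP
  simp only [Function.comp_def, Pi.mul_apply, Pi.sub_apply, Pi.inv_apply, pow_succ _ n]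
  generalize (z / 2) ^ n = W at *
  generalize logNegImCut (z / 2) = l at *
  generalize besA n (z ^ 2 / 4) = a0 at *
  generalize besA (n + 1) (z ^ 2 / 4) = a1 at *
  generalize besB n (z ^ 2 / 4) = b0 at *
  generalize besB (n + 1) (z ^ 2 / 4) = b1 at *
  generalize besP n (z ^ 2 / 4) = p0 at *
  have eP' : besP (n + 1) (z ^ 2 / 4) = n * p0 - z ^ 2 / 4 * p' + W * W / n.factorial := by
    linear_combination -eP
  have ea : a0 = z ^ 2 / 4 * b' + z ^ 2 / 4 * b1 + 1 / n.factorial := by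
    linear_combination -eB
  rw [eP', ea]
  field_simp
  ring

/-- Each of `besA`, `besB` and `besP` has its own three-term relation. For `besB` it results from
equating two expressions for the derivative of `besB (n + 1)`. -/
theorem hankelH_three_term (n : ℕ) {z : ℂ} (hz : z ≠ 0) :
    2 * ((n : ℂ) + 1) / z * hankelH (n + 1) z = hankelH n z + hankelH (n + 2) z := by
  obtain ⟨b', hb, eB⟩ := exists_hasDerivAt_besB (n + 1) (z ^ 2 / 4)
  have eB' := hasDerivAt_besB_succ n _ hb
  obtain ⟨p', hp, eP⟩ := exists_hasDerivAt_besP (n + 1) (z ^ 2 / 4)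
  have eA := besA_recurrence n (z ^ 2 / 4)
  have ep : p' = besP n (z ^ 2 / 4) := hp.unique (hasDerivAt_besP_succ n _)
  have hW : (z / 2) ^ n ≠ 0 := pow_ne_zero _ (div_ne_zero hz two_ne_zero)
  have hsn : (z ^ 2 / 4) ^ (n + 1) = (z / 2) ^ n * (z / 2) ^ n * (z ^ 2 / 4) := by
    rw [pow_succ, ← mul_pow]; congr 2; ring
  rw [hsn, ep] at eP
  have hpi : (Real.pi : ℂ) ≠ 0 := by exact_mod_cast Real.pi_ne_zero
  have hf : ((n + 1).factorial : ℂ) ≠ 0 := Nat.cast_ne_zero.2 (n + 1).factorial_ne_zero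
  rw [hankelH_eq, hankelH_eq, hankelH_eq]
  simp only [pow_succ _ (n + 1), pow_succ _ n]
  push_cast at eP
  rw [show n + 1 + 1 = n + 2 from rfl] at *
  generalize (z / 2) ^ n = W at *
  generalize logNegImCut (z / 2) = l at *
  have ea : besA n (z ^ 2 / 4) = _ := eA.symm
  have eb : besB n (z ^ 2 / 4) = ((n : ℂ) + 1) * besB (n + 1) (z ^ 2 / 4)
      - z ^ 2 / 4 * besB (n + 2) (z ^ 2 / 4) - 1 / (n + 1).factorial := by
    linear_combination eB - eB'
  have eP' : besP (n + 2) (z ^ 2 / 4) = ((n : ℂ) + 1) * besP (n + 1) (z ^ 2 / 4)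
      - z ^ 2 / 4 * besP n (z ^ 2 / 4) + W * W * (z ^ 2 / 4) / (n + 1).factorial := by
    linear_combination -eP
  rw [ea, eb, eP']
  field_simp
  ring

/-- Ladder relation `(z^{n+1} H_{n+1})' = z^{n+1} H_n`. -/
theorem hasDerivAt_hankelH_succ (n : ℕ) {z : ℂ} (hz : 0 < z.im) :
    HasDerivAt (hankelH (n + 1)) (hankelH n z - ((n : ℂ) + 1) / z * hankelH (n + 1) z) z := by
  have hz0 : z ≠ 0 := by rintro rfl; simp at hz
  refine (hasDerivAt_hankelH (n + 1) hz).congr_deriv ?_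
  have := hankelH_three_term n hz0
  push_cast
  linear_combination this

/-! ### The integrals of `cosh(t)^m exp(i z cosh t)`. -/

/-- Half of the exponent absorbs the power of `cosh`; the other half decays in `t` because `t ≤ cosh
t`. -/
theorem cosh_pow_mul_exp_neg_le (m : ℕ) {y t : ℝ} (hy : 0 < y) (ht : 0 ≤ t) :
    Real.cosh t ^ m * Real.exp (-(y * Real.cosh t)) ≤
      m.factorial * (2 / y) ^ m * Real.exp (-(y / 2) * t) := by
  have hc : 0 < Real.cosh t := Real.cosh_pos t
  have h1 := Real.pow_div_factorial_le_exp (y / 2 * Real.cosh t) (by positivity) m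
  have hf : (0 : ℝ) < m.factorial := by exact_mod_cast m.factorial_pos
  have h2 : Real.cosh t ^ m ≤
      m.factorial * (2 / y) ^ m * Real.exp (y / 2 * Real.cosh t) := by
    rw [div_le_iff₀ hf] at h1
    calc Real.cosh t ^ m = (2 / y) ^ m * (y / 2 * Real.cosh t) ^ m := by
          rw [← mul_pow]; congr 1; field_simp
      _ ≤ (2 / y) ^ m * (Real.exp (y / 2 * Real.cosh t) * m.factorial) := by gcongr
      _ = _ := by ring
  have h3 : t ≤ Real.cosh t := (Real.self_le_sinh_iff.2 ht).trans (Real.sinh_lt_cosh t).le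
  calc _ ≤ m.factorial * (2 / y) ^ m * Real.exp (y / 2 * Real.cosh t)
        * Real.exp (-(y * Real.cosh t)) := by gcongr
    _ = m.factorial * (2 / y) ^ m * Real.exp (-(y / 2) * Real.cosh t) := by
        rw [mul_assoc, ← Real.exp_add]; congr 2; ring
    _ ≤ _ := mul_le_mul_of_nonneg_left (Real.exp_le_exp.2 (by nlinarith)) (by positivity)

theorem integrableOn_cosh_pow_mul_exp_neg (m : ℕ) {y : ℝ} (hy : 0 < y) :
    IntegrableOn (fun t => Real.cosh t ^ m * Real.exp (-(y * Real.cosh t))) (Ioi 0) := by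
  refine ((integrableOn_exp_mul_Ioi (by linarith : -(y / 2) < 0) 0).const_mul
    (m.factorial * (2 / y) ^ m)).mono' (Continuous.aestronglyMeasurable (by fun_prop)) ?_
  refine (ae_restrict_iff' measurableSet_Ioi).2 (Eventually.of_forall fun t ht => ?_)
  rw [Real.norm_of_nonneg (by positivity)]
  exact cosh_pow_mul_exp_neg_le m hy (le_of_lt ht)

/-- The real integrals `∫₀^∞ cosh(t)^m exp(-y cosh t) dt`. -/
def coshIntegral (m : ℕ) (y : ℝ) : ℝ :=
  ∫ t in Ioi (0 : ℝ), Real.cosh t ^ m * Real.exp (-(y * Real.cosh t))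

/-- The integrals `∫₀^∞ cosh(t)^m exp(i z cosh t) dt`, convergent in the upper half-plane. -/
def besG (m : ℕ) (z : ℂ) : ℂ :=
  ∫ t in Ioi (0 : ℝ), (Real.cosh t : ℂ) ^ m * Complex.exp (I * z * Real.cosh t)

theorem norm_cosh_pow_mul_cexp (m : ℕ) (z : ℂ) (t : ℝ) :
    ‖(Real.cosh t : ℂ) ^ m * Complex.exp (I * z * Real.cosh t)‖ =
      Real.cosh t ^ m * Real.exp (-(z.im * Real.cosh t)) := by
  rw [norm_mul, norm_pow, Complex.norm_exp, Complex.norm_real,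
    Real.norm_of_nonneg (Real.cosh_pos t).le]
  congr 2
  simp [Complex.mul_re, Complex.mul_im]

theorem integrableOn_cosh_pow_mul_cexp (m : ℕ) {z : ℂ} (hz : 0 < z.im) :
    IntegrableOn (fun t : ℝ => (Real.cosh t : ℂ) ^ m * Complex.exp (I * z * Real.cosh t))
      (Ioi 0) := by
  refine (integrableOn_cosh_pow_mul_exp_neg m hz).mono'
    (Continuous.aestronglyMeasurable (by fun_prop)) (Eventually.of_forall fun t => ?_)
  exact (norm_cosh_pow_mul_cexp m z t).le

theorem besG_I_mul (m : ℕ) (y : ℝ) : besG m (I * y) = (coshIntegral m y : ℂ) := by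
  rw [besG, coshIntegral, ← integral_complex_ofReal]
  refine integral_congr_ae (Eventually.of_forall fun t => ?_)
  simp only
  push_cast
  congr 2
  linear_combination (y : ℂ) * Complex.cosh t * I_mul_I

theorem hasDerivAt_besG (m : ℕ) {z : ℂ} (hz : 0 < z.im) :
    HasDerivAt (besG m) (I * besG (m + 1) z) z := by
  -- On this half-plane a single integrable function dominates all the `z`-derivatives.
  have hs : {w : ℂ | z.im / 2 < w.im} ∈ 𝓝 z :=
    (isOpen_lt continuous_const Complex.continuous_im).mem_nhds
      (show z.im / 2 < z.im by linarith)
  have h := hasDerivAt_integral_of_dominated_loc_of_deriv_le (μ := volume.restrict (Ioi (0 : ℝ)))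
    (F := fun (z : ℂ) (t : ℝ) => (Real.cosh t : ℂ) ^ m * Complex.exp (I * z * Real.cosh t))
    (F' := fun (z : ℂ) (t : ℝ) =>
      I * ((Real.cosh t : ℂ) ^ (m + 1) * Complex.exp (I * z * Real.cosh t)))
    (bound := fun t => Real.cosh t ^ (m + 1) * Real.exp (-(z.im / 2 * Real.cosh t))) hs
    (Eventually.of_forall fun w => Continuous.aestronglyMeasurable (by fun_prop))
    (integrableOn_cosh_pow_mul_cexp m hz)
    (Continuous.aestronglyMeasurable (by fun_prop))
    (Eventually.of_forall fun t w hw => ?_)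
    (integrableOn_cosh_pow_mul_exp_neg (m + 1) (by linarith))
    (Eventually.of_forall fun t w hw => ?_)
  · refine h.2.congr_deriv ?_
    rw [integral_const_mul, besG]
  · rw [norm_mul, norm_I, one_mul, norm_cosh_pow_mul_cexp]
    have hw' : z.im / 2 ≤ w.im := le_of_lt hw
    have := Real.cosh_pos t
    gcongr
  · have h1 : HasDerivAt (fun w : ℂ => I * w * Real.cosh t) (I * Real.cosh t) w := by
      simpa using ((hasDerivAt_id w).const_mul I).mul_const (Real.cosh t : ℂ)
    refine (h1.cexp.const_mul _).congr_deriv ?_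
    rw [pow_succ]; ring

/-- Since `cosh t ≥ 1`, for `y ≥ 1` one has `exp(-y cosh t) ≤ exp(1 - y) exp(-cosh t)`. -/
theorem norm_besG_le (m : ℕ) {z : ℂ} (hz : 1 ≤ z.im) :
    ‖besG m z‖ ≤ Real.exp 1 * coshIntegral m 1 * Real.exp (-z.im) := by
  refine (norm_integral_le_integral_norm _).trans ?_
  simp only [norm_cosh_pow_mul_cexp]
  have hc : Real.exp 1 * coshIntegral m 1 * Real.exp (-z.im) =
      ∫ t in Ioi (0 : ℝ), Real.exp (1 - z.im) *
        (Real.cosh t ^ m * Real.exp (-(1 * Real.cosh t))) := by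
    rw [integral_const_mul, ← coshIntegral, sub_eq_add_neg, Real.exp_add]; ring
  rw [hc]
  refine integral_mono (integrableOn_cosh_pow_mul_exp_neg m (by linarith))
    ((integrableOn_cosh_pow_mul_exp_neg m one_pos).const_mul _) fun t => ?_
  simp only
  rw [mul_left_comm, ← Real.exp_add]
  have := Real.one_le_cosh t
  have := Real.cosh_pos t
  gcongr
  nlinarith

/-- `besG 0` satisfies Bessel's equation of order zero. -/
theorem besG_bessel {z : ℂ} (hz : 0 < z.im) :
    besG 1 z + I * z * (besG 2 z - besG 0 z) = 0 := by
  -- The identity is the integral of the derivative of `sinh t · exp(i z cosh t)`, which vanishes at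
  -- `t = 0` and at infinity; `sinh² = cosh² - 1` brings in the powers of `cosh`.
  have hd : ∀ t ∈ Ici (0 : ℝ), HasDerivAt
      (fun t : ℝ => (Real.sinh t : ℂ) * Complex.exp (I * z * Real.cosh t))
      ((Real.cosh t : ℂ) ^ 1 * Complex.exp (I * z * Real.cosh t) + I * z *
        ((Real.cosh t : ℂ) ^ 2 * Complex.exp (I * z * Real.cosh t)
          - (Real.cosh t : ℂ) ^ 0 * Complex.exp (I * z * Real.cosh t))) t := by
    intro t _
    have h1 := (Real.hasDerivAt_sinh t).ofReal_comp
    have h2 := ((Real.hasDerivAt_cosh t).ofReal_comp.const_mul (I * z)).cexp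
    refine (h1.mul h2).congr_deriv ?_
    have h3 : (Real.cosh t : ℂ) ^ 2 = (Real.sinh t : ℂ) ^ 2 + 1 := by
      exact_mod_cast Real.cosh_sq t
    linear_combination -I * z * Complex.exp (I * z * Real.cosh t) * h3
  have i0 := integrableOn_cosh_pow_mul_cexp 0 hz
  have i1 := integrableOn_cosh_pow_mul_cexp 1 hz
  have i2 := integrableOn_cosh_pow_mul_cexp 2 hz
  have hlim : Tendsto (fun t : ℝ => (Real.sinh t : ℂ) * Complex.exp (I * z * Real.cosh t))
      atTop (𝓝 0) := by
    have h0 : Tendsto (fun t : ℝ => ((1).factorial : ℝ) * (2 / z.im) ^ 1 *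
        Real.exp (-(z.im / 2) * t)) atTop (𝓝 0) := by
      have : Tendsto (fun t : ℝ => -(z.im / 2) * t) atTop atBot :=
        tendsto_id.const_mul_atTop_of_neg (by linarith)
      have := (Real.tendsto_exp_atBot.comp this).const_mul
        (((1).factorial : ℝ) * (2 / z.im) ^ 1)
      rwa [mul_zero] at this
    refine squeeze_zero_norm' ?_ h0
    filter_upwards [eventually_ge_atTop 0] with t ht
    refine le_trans ?_ (cosh_pow_mul_exp_neg_le 1 hz ht)
    rw [← norm_cosh_pow_mul_cexp, norm_mul, norm_mul, pow_one, Complex.norm_real,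
      Complex.norm_real, Real.norm_of_nonneg (Real.sinh_nonneg_iff.2 ht),
      Real.norm_of_nonneg (Real.cosh_pos t).le]
    gcongr
    exact (Real.sinh_lt_cosh t).le
  have h := integral_Ioi_of_hasDerivAt_of_tendsto' hd (i1.add ((i2.sub i0).const_mul (I * z))) hlim
  have e1 := integral_add i1 ((i2.sub i0).const_mul (I * z))
  have e2 := integral_sub i2 i0
  simp only [Pi.sub_apply] at e1
  rw [e1, integral_const_mul, e2] at h
  simpa [besG] using h

theorem coshIntegral_zero_one_pos : 0 < coshIntegral 0 1 := by
  rw [coshIntegral, setIntegral_pos_iff_support_of_nonneg_ae]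
  · have : Function.support (fun t => Real.cosh t ^ 0 * Real.exp (-(1 * Real.cosh t)))
        = univ := by
      ext t; simp [Real.exp_ne_zero]
    rw [this]; simp
  · exact Eventually.of_forall fun t => by positivity
  · exact integrableOn_cosh_pow_mul_exp_neg 0 one_pos

/-! ### Behaviour of the integrals at the origin. -/

/-- The integral is `Γ'(1)`, obtained by differentiating Euler's integral. -/
theorem integral_log_mul_exp_neg :
    ∫ t in Ioi (0 : ℝ), Real.log t * Real.exp (-t) = -Real.eulerMascheroniConstant := by
  have h1 := Complex.hasDerivAt_GammaIntegral (s := 1) (by simp)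
  have h2 : HasDerivAt Complex.GammaIntegral (-(Real.eulerMascheroniConstant : ℂ)) 1 := by
    refine Complex.hasDerivAt_Gamma_one.congr_of_eventuallyEq ?_
    filter_upwards [(isOpen_lt continuous_const Complex.continuous_re).mem_nhds
      (show (0 : ℝ) < (1 : ℂ).re by simp)] with s hs
    exact (Complex.Gamma_eq_integral hs).symm
  have h3 := h1.unique h2
  rw [← ofReal_inj, ← integral_complex_ofReal]
  push_cast
  rw [← h3]
  refine integral_congr_ae (Eventually.of_forall fun t => ?_)
  simp

/-- A non-integrable function has Bochner integral `0` by convention, whereas this integral has the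
nonzero value `-γ`. -/
theorem integrableOn_log_mul_exp_neg :
    IntegrableOn (fun t => Real.log t * Real.exp (-t)) (Ioi (0 : ℝ)) := by
  by_contra h
  have h1 := integral_undef h
  rw [integral_log_mul_exp_neg] at h1
  linarith [Real.one_half_lt_eulerMascheroniConstant]

theorem integrableOn_exp_neg_div {x : ℝ} (hx : 0 < x) :
    IntegrableOn (fun s => Real.exp (-s) / s) (Ioi x) := by
  refine ((integrableOn_exp_neg_Ioi x).div_const x).mono'
    (Measurable.aestronglyMeasurable (by fun_prop)) ?_
  refine (ae_restrict_iff' measurableSet_Ioi).2 (Eventually.of_forall fun s hs => ?_)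
  have hs' : x < s := hs
  have : 0 < s := hx.trans hs'
  rw [Real.norm_of_nonneg (by positivity)]
  gcongr

/-- The exponential integral, by parts. -/
theorem integral_exp_neg_div {x : ℝ} (hx : 0 < x) :
    ∫ s in Ioi x, Real.exp (-s) / s =
      (∫ s in Ioi x, Real.log s * Real.exp (-s)) - Real.log x * Real.exp (-x) := by
  have hd : ∀ s ∈ Ici x, HasDerivAt (fun s => Real.log s * Real.exp (-s))
      (Real.exp (-s) / s - Real.log s * Real.exp (-s)) s := by
    intro s hs
    have hs' : s ≠ 0 := (hx.trans_le hs).ne'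
    refine ((Real.hasDerivAt_log hs').mul (hasDerivAt_neg s).exp).congr_deriv ?_
    ring
  have hlim : Tendsto (fun s => Real.log s * Real.exp (-s)) atTop (𝓝 0) := by
    refine squeeze_zero_norm' ?_ (Real.tendsto_pow_mul_exp_neg_atTop_nhds_zero 1)
    filter_upwards [eventually_ge_atTop 1] with s hs
    rw [Real.norm_of_nonneg (mul_nonneg (Real.log_nonneg hs) (Real.exp_pos _).le), pow_one]
    gcongr
    exact Real.log_le_self (by linarith)
  have i1 := integrableOn_exp_neg_div hx
  have i2 : IntegrableOn (fun s => Real.log s * Real.exp (-s)) (Ioi x) :=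
    integrableOn_log_mul_exp_neg.mono_set (Ioi_subset_Ioi hx.le)
  have h := integral_Ioi_of_hasDerivAt_of_tendsto' hd (i1.sub i2) hlim
  rw [integral_sub i1 i2] at h
  linarith

theorem image_mul_exp_Ioi {x : ℝ} (hx : 0 < x) :
    (fun t => x * Real.exp t) '' Ioi 0 = Ioi x := by
  ext s
  simp only [mem_image, mem_Ioi]
  constructor
  · rintro ⟨t, ht, rfl⟩
    have := Real.one_lt_exp_iff.2 ht
    nlinarith
  · intro hs
    refine ⟨Real.log (s / x), Real.log_pos (by rwa [one_lt_div hx]), ?_⟩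
    rw [Real.exp_log (div_pos (hx.trans hs) hx)]
    field_simp

theorem exp_integral_change {x : ℝ} (hx : 0 < x) :
    IntegrableOn (fun t => Real.exp (-(x * Real.exp t))) (Ioi 0) ∧
    ∫ t in Ioi (0 : ℝ), Real.exp (-(x * Real.exp t)) = ∫ s in Ioi x, Real.exp (-s) / s := by
  have hf : ∀ t ∈ Ioi (0 : ℝ), HasDerivWithinAt (fun t => x * Real.exp t) (x * Real.exp t)
      (Ioi 0) t := fun t _ => ((Real.hasDerivAt_exp t).const_mul x).hasDerivWithinAt
  have hinj : InjOn (fun t => x * Real.exp t) (Ioi 0) := fun a _ b _ h =>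
    Real.exp_injective (mul_left_cancel₀ hx.ne' h)
  have heq : ∀ t : ℝ, |x * Real.exp t| • (Real.exp (-(x * Real.exp t)) / (x * Real.exp t))
      = Real.exp (-(x * Real.exp t)) := by
    intro t
    have : 0 < x * Real.exp t := by positivity
    rw [abs_of_pos this, smul_eq_mul, mul_div_cancel₀ _ this.ne']
  have h1 := integrableOn_image_iff_integrableOn_abs_deriv_smul measurableSet_Ioi hf hinj
    (fun s => Real.exp (-s) / s)
  have h2 := integral_image_eq_integral_abs_deriv_smul measurableSet_Ioi hf hinj
    (fun s => Real.exp (-s) / s)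
  rw [image_mul_exp_Ioi hx] at h1 h2
  simp only [heq] at h1 h2
  exact ⟨h1.1 (integrableOn_exp_neg_div hx), h2.symm⟩

/-- With `s = x exp t` the integral becomes the exponential integral. Integration by parts isolates
`-log x · exp(-x)`, and `log x · (1 - exp(-x))` tends to `0`. -/
theorem tendsto_exp_integral_add_log :
    Tendsto (fun x => (∫ t in Ioi (0 : ℝ), Real.exp (-(x * Real.exp t))) + Real.log x) (𝓝[>] 0)
      (𝓝 (-Real.eulerMascheroniConstant)) := by
  have h1 : Tendsto (fun x => ∫ s in Ioi x, Real.log s * Real.exp (-s)) (𝓝[>] (0 : ℝ))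
      (𝓝 (-Real.eulerMascheroniConstant)) := by
    rw [← integral_log_mul_exp_neg]
    have hc : AECover (volume.restrict (Ioi (0 : ℝ))) (𝓝[>] (0 : ℝ)) fun x => Ioi x :=
      aecover_Ioi_of_Ioi (tendsto_id.mono_left nhdsWithin_le_nhds)
    refine (hc.integral_tendsto_of_countably_generated integrableOn_log_mul_exp_neg).congr' ?_
    filter_upwards [self_mem_nhdsWithin] with x hx
    rw [Measure.restrict_restrict measurableSet_Ioi,
      inter_eq_left.2 (Ioi_subset_Ioi (le_of_lt hx))]
  have h2 : Tendsto (fun x => Real.log x * (1 - Real.exp (-x))) (𝓝[>] (0 : ℝ)) (𝓝 0) := by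
    have h3 : Tendsto (fun x => Real.log x * x) (𝓝[>] (0 : ℝ)) (𝓝 0) := by
      simpa using tendsto_log_mul_rpow_nhdsGT_zero zero_lt_one
    have h4 : Tendsto (fun x => |Real.log x * x|) (𝓝[>] (0 : ℝ)) (𝓝 0) := by simpa using h3.abs
    refine squeeze_zero_norm' ?_ h4
    filter_upwards [self_mem_nhdsWithin] with x hx
    have hx' : 0 < x := hx
    rw [Real.norm_eq_abs, abs_mul, abs_mul]
    refine mul_le_mul_of_nonneg_left ?_ (abs_nonneg _)
    have h1 : Real.exp (-x) ≤ 1 := Real.exp_le_one_iff.2 (by linarith)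
    rw [abs_of_pos hx', abs_of_nonneg (by linarith)]
    linarith [Real.one_sub_le_exp_neg x]
  have h := h1.add h2
  rw [add_zero] at h
  refine h.congr' ?_
  filter_upwards [self_mem_nhdsWithin] with x hx
  rw [(exp_integral_change hx).2, integral_exp_neg_div hx]
  ring

theorem tendsto_half_nhdsGT_zero : Tendsto (fun y : ℝ => y / 2) (𝓝[>] 0) (𝓝[>] 0) := by
  refine tendsto_nhdsWithin_of_tendsto_nhds_of_eventually_within _ ?_ ?_
  · have : Tendsto (fun y : ℝ => y / 2) (𝓝 0) (𝓝 (0 / 2)) := tendsto_id.div_const 2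
    rw [zero_div] at this
    exact this.mono_left nhdsWithin_le_nhds
  · filter_upwards [self_mem_nhdsWithin] with y hy
    exact half_pos (show 0 < y from hy)

/-- `K₀(y) = -log (y/2) - γ + o(1)` as `y → 0+`. -/
theorem tendsto_coshIntegral_zero_add_log :
    Tendsto (fun y => coshIntegral 0 y + Real.log (y / 2)) (𝓝[>] 0)
      (𝓝 (-Real.eulerMascheroniConstant)) := by
  have h1 := tendsto_exp_integral_add_log.comp tendsto_half_nhdsGT_zero
  -- Replacing `y cosh t` by `(y / 2) exp t` changes the integrand by at most `(y / 2) exp(-t)`,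
  -- hence the integral by at most `y / 2`.
  have h2 : Tendsto (fun y => coshIntegral 0 y -
      ∫ t in Ioi (0 : ℝ), Real.exp (-(y / 2 * Real.exp t))) (𝓝[>] (0 : ℝ)) (𝓝 0) := by
    refine squeeze_zero_norm' ?_ (tendsto_half_nhdsGT_zero.mono_right nhdsWithin_le_nhds)
    filter_upwards [self_mem_nhdsWithin] with y hy
    have hy' : 0 < y := hy
    rw [coshIntegral, ← integral_sub (integrableOn_cosh_pow_mul_exp_neg 0 hy)
      (exp_integral_change (half_pos hy')).1]
    have hb : ∫ t in Ioi (0 : ℝ), y / 2 * Real.exp (-t) = y / 2 := by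
      rw [integral_const_mul, integral_exp_neg_Ioi_zero, mul_one]
    refine le_trans (norm_integral_le_of_norm_le ((integrableOn_exp_neg_Ioi 0).const_mul (y / 2))
      (Eventually.of_forall fun t => ?_)) hb.le
    have e : Real.exp (-(y * Real.cosh t)) =
        Real.exp (-(y / 2 * Real.exp t)) * Real.exp (-(y / 2 * Real.exp (-t))) := by
      rw [← Real.exp_add, Real.cosh_eq]; congr 1; ring
    have h0 := Real.exp_pos (-t)
    have h3 : Real.exp (-(y / 2 * Real.exp t)) ≤ 1 :=
      Real.exp_le_one_iff.2 (by have := Real.exp_pos t; nlinarith [mul_pos hy' this])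
    have h4 := Real.one_sub_le_exp_neg (y / 2 * Real.exp (-t))
    have h5 : Real.exp (-(y / 2 * Real.exp (-t))) ≤ 1 :=
      Real.exp_le_one_iff.2 (by nlinarith [mul_pos hy' h0])
    have h6 := Real.exp_pos (-(y / 2 * Real.exp t))
    rw [pow_zero, one_mul, e, Real.norm_eq_abs, abs_sub_comm, abs_of_nonneg (by nlinarith)]
    nlinarith
  have h := h2.add h1
  rw [zero_add] at h
  refine h.congr fun y => ?_
  simp only [Function.comp]
  ring

/-- `y K₁(y) → 1` as `y → 0+`. -/
theorem tendsto_mul_coshIntegral_one :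
    Tendsto (fun y => y * coshIntegral 1 y) (𝓝[>] 0) (𝓝 1) := by
  -- With `sinh` in place of `cosh` the integral is exactly `exp(-y)`; since `cosh t - sinh t =
  -- exp(-t)`, the error is at most `y`.
  have key : ∀ y : ℝ, 0 < y → |y * coshIntegral 1 y - Real.exp (-y)| ≤ y := by
    intro y hy
    have hd : ∀ t ∈ Ici (0 : ℝ), HasDerivAt (fun t => -Real.exp (-(y * Real.cosh t)))
        (y * Real.sinh t * Real.exp (-(y * Real.cosh t))) t := by
      intro t _
      refine ((Real.hasDerivAt_cosh t).const_mul y).neg.exp.neg.congr_deriv ?_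
      simp only [Pi.neg_apply]
      ring
    have hlim : Tendsto (fun t => -Real.exp (-(y * Real.cosh t))) atTop (𝓝 0) := by
      have h0 : Tendsto (fun t : ℝ => ((0).factorial : ℝ) * (2 / y) ^ 0 *
          Real.exp (-(y / 2) * t)) atTop (𝓝 0) := by
        have : Tendsto (fun t : ℝ => -(y / 2) * t) atTop atBot :=
          tendsto_id.const_mul_atTop_of_neg (by linarith)
        have := (Real.tendsto_exp_atBot.comp this).const_mul
          (((0).factorial : ℝ) * (2 / y) ^ 0)
        rwa [mul_zero] at this
      refine squeeze_zero_norm' ?_ h0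
      filter_upwards [eventually_ge_atTop 0] with t ht
      have := cosh_pow_mul_exp_neg_le 0 hy ht
      rw [norm_neg, Real.norm_of_nonneg (Real.exp_pos _).le]
      linarith
    have hpos : ∀ t ∈ Ioi (0 : ℝ), 0 ≤ y * Real.sinh t * Real.exp (-(y * Real.cosh t)) := by
      intro t ht
      have : 0 ≤ Real.sinh t := Real.sinh_nonneg_iff.2 (le_of_lt ht)
      positivity
    have hi := integrableOn_Ioi_deriv_of_nonneg' hd hpos hlim
    have hs := integral_Ioi_of_hasDerivAt_of_tendsto' hd hi hlim
    simp only [Real.cosh_zero, mul_one, sub_neg_eq_add, zero_add] at hs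
    have hi1 := (integrableOn_cosh_pow_mul_exp_neg 1 hy).const_mul y
    have hb : ∫ t in Ioi (0 : ℝ), y * Real.exp (-t) = y := by
      rw [integral_const_mul, integral_exp_neg_Ioi_zero, mul_one]
    rw [← hs, coshIntegral, ← integral_const_mul, ← integral_sub hi1 hi, ← Real.norm_eq_abs]
    refine le_trans (norm_integral_le_of_norm_le ((integrableOn_exp_neg_Ioi 0).const_mul y)
      (Eventually.of_forall fun t => ?_)) hb.le
    have e : y * (Real.cosh t ^ 1 * Real.exp (-(y * Real.cosh t))) -
        y * Real.sinh t * Real.exp (-(y * Real.cosh t)) =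
        y * (Real.exp (-t) * Real.exp (-(y * Real.cosh t))) := by
      generalize Real.exp (-(y * Real.cosh t)) = w
      rw [← Real.cosh_sub_sinh]; ring
    rw [e, Real.norm_of_nonneg (by positivity)]
    have : Real.exp (-(y * Real.cosh t)) ≤ 1 :=
      Real.exp_le_one_iff.2 (by have := Real.cosh_pos t; nlinarith [mul_pos hy this])
    have h0 := Real.exp_pos (-t)
    nlinarith [mul_le_mul_of_nonneg_left this h0.le]
  have hid : Tendsto (fun y : ℝ => y) (𝓝[>] 0) (𝓝 0) :=
    tendsto_id.mono_left nhdsWithin_le_nhds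
  have h1 : Tendsto (fun y => y * coshIntegral 1 y - Real.exp (-y)) (𝓝[>] 0) (𝓝 0) := by
    refine squeeze_zero_norm' ?_ hid
    filter_upwards [self_mem_nhdsWithin] with y hy using key y hy
  have h2 : Tendsto (fun y : ℝ => Real.exp (-y)) (𝓝[>] 0) (𝓝 1) := by
    have : Tendsto (fun y : ℝ => Real.exp (-y)) (𝓝 0) (𝓝 (Real.exp (-0))) :=
      Continuous.tendsto (by fun_prop) 0
    rw [neg_zero, Real.exp_zero] at this
    exact this.mono_left nhdsWithin_le_nhds
  have h := h1.add h2
  rw [zero_add] at h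
  exact h.congr fun y => by ring

/-! ### Behaviour of `H_0` and `H_1` at the origin along the imaginary axis. -/

theorem logNegImCut_I_mul_half {y : ℝ} (hy : 0 < y) :
    logNegImCut (I * y / 2) = (Real.log (y / 2) : ℂ) + I * (Real.pi / 2) := by
  rw [logNegImCut, Complex.ofReal_log (by positivity)]
  congr 2
  push_cast
  linear_combination (-(y : ℂ) / 2) * I_mul_I

theorem tendsto_log_half_mul : Tendsto (fun y : ℝ => Real.log (y / 2) * y) (𝓝[>] 0) (𝓝 0) := by
  have h3 : Tendsto (fun x => Real.log x * x) (𝓝[>] (0 : ℝ)) (𝓝 0) := by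
    simpa using tendsto_log_mul_rpow_nhdsGT_zero zero_lt_one
  have := (h3.comp tendsto_half_nhdsGT_zero).mul_const 2
  rw [zero_mul] at this
  refine this.congr fun y => ?_
  simp only [Function.comp]
  ring

theorem tendsto_comp_neg_sq {f : ℂ → ℂ} (hf : ContinuousAt f 0) :
    Tendsto (fun y : ℝ => f ((I * y) ^ 2 / 4)) (𝓝[>] 0) (𝓝 (f 0)) := by
  have h : Tendsto (fun y : ℝ => (I * (y : ℂ)) ^ 2 / 4) (𝓝[>] 0) (𝓝 0) := by
    have : Tendsto (fun y : ℝ => (I * (y : ℂ)) ^ 2 / 4) (𝓝 0)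
        (𝓝 ((I * ((0 : ℝ) : ℂ)) ^ 2 / 4)) := Continuous.tendsto (by fun_prop) 0
    simp only [ofReal_zero, mul_zero, ne_eq, OfNat.ofNat_ne_zero, not_false_eq_true, zero_pow,
      zero_div] at this
    exact this.mono_left nhdsWithin_le_nhds
  exact hf.tendsto.comp h

theorem continuous_besA (n : ℕ) : Continuous (besA n) :=
  continuous_iff_continuousAt.2 fun s => (hasDerivAt_besA n s).continuousAt

theorem continuous_besB (n : ℕ) : Continuous (besB n) :=
  continuous_iff_continuousAt.2 fun s =>
    let ⟨_, h, _⟩ := exists_hasDerivAt_besB n s; h.continuousAt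

theorem besA_zero_zero : besA 0 0 = 1 := by
  have h := hasSum_besA 0 0
  refine h.unique ((hasSum_ite_eq 0 (1 : ℂ)).of_eq (fun m => ?_) rfl)
  rcases m with _ | m <;> simp [coeffA]

theorem besB_zero_zero : besB 0 0 = -2 * Real.eulerMascheroniConstant := by
  have h := hasSum_besB 0 0
  refine h.unique ((hasSum_ite_eq 0 (-2 * Real.eulerMascheroniConstant : ℂ)).of_eq
    (fun m => ?_) rfl)
  rcases m with _ | m
  · simp [coeffB, coeffA, Complex.digamma_one]; ring
  · simp

/-- `J_0 - 1` has zero derivative at the origin, so it is `o(y)`, while `y log (y / 2)` tends to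
`0`. -/
theorem tendsto_log_half_mul_besA_sub_one :
    Tendsto (fun y : ℝ => (Real.log (y / 2) : ℂ) * (besA 0 ((I * y) ^ 2 / 4) - 1)) (𝓝[>] 0)
      (𝓝 0) := by
  have hd : HasDerivAt (fun z : ℂ => besA 0 ((I * z) ^ 2 / 4)) 0 0 := by
    have h1 : HasDerivAt (fun z : ℂ => (I * z) ^ 2 / 4) 0 0 := by
      have := ((((hasDerivAt_id (0 : ℂ)).const_mul I).pow 2).div_const 4)
      simpa using this
    have := (hasDerivAt_besA 0 ((I * 0) ^ 2 / 4)).comp 0 h1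
    exact this.congr_deriv (mul_zero _)
  have hs := hasDerivAt_iff_tendsto_slope_zero.1 hd.comp_ofReal
  have hs' : Tendsto (fun t : ℝ => t⁻¹ • (besA 0 ((I * t) ^ 2 / 4) - 1)) (𝓝[>] 0) (𝓝 0) := by
    refine (hs.mono_left (nhdsWithin_mono _ fun x hx => (ne_of_gt hx))).congr fun t => ?_
    simp [besA_zero_zero]
  have hl : Tendsto (fun y : ℝ => ((Real.log (y / 2) * y : ℝ) : ℂ)) (𝓝[>] 0) (𝓝 ((0 : ℝ) : ℂ)) :=
    (Complex.continuous_ofReal.tendsto 0).comp tendsto_log_half_mul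
  have h := hl.mul hs'
  rw [mul_zero] at h
  refine h.congr' ?_
  filter_upwards [self_mem_nhdsWithin] with y hy
  have hy' : (y : ℂ) ≠ 0 := by exact_mod_cast (ne_of_gt (show 0 < y from hy))
  rw [Complex.real_smul]
  push_cast
  field_simp

/-- On the imaginary axis the term `iπ/2` of the logarithm, multiplied by `2i/π`, cancels the
summand `1` coming from `J_0`. The limit is then `-(i/π)` times `besB 0 0 = -2γ`. -/
theorem tendsto_hankelH_zero_sub_log :
    Tendsto (fun y : ℝ => hankelH 0 (I * y) - 2 * I / Real.pi * Real.log (y / 2)) (𝓝[>] 0)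
      (𝓝 (2 * I / Real.pi * Real.eulerMascheroniConstant)) := by
  have h1 := tendsto_log_half_mul_besA_sub_one.const_mul (2 * I / Real.pi : ℂ)
  have h2 := (tendsto_comp_neg_sq (continuous_besB 0).continuousAt).const_mul (I / Real.pi : ℂ)
  have h := h1.sub h2
  rw [besB_zero_zero] at h
  have e : 2 * I / Real.pi * 0 - I / Real.pi * (-2 * Real.eulerMascheroniConstant : ℂ) =
    2 * I / Real.pi * Real.eulerMascheroniConstant := by ring
  rw [e] at h
  refine h.congr' ?_
  filter_upwards [self_mem_nhdsWithin] with y hy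
  have hpi : (Real.pi : ℂ) ≠ 0 := by exact_mod_cast Real.pi_ne_zero
  rw [hankelH_eq, logNegImCut_I_mul_half hy]
  simp only [besP, pow_zero, Finset.range_zero, Finset.sum_empty]
  field_simp
  ring_nf
  simp only [I_sq]
  ring

/-- Only the pole of `Y_1`, the `besP` term, survives multiplication by `z`. -/
theorem tendsto_mul_hankelH_one :
    Tendsto (fun y : ℝ => (I * y) * hankelH 1 (I * y)) (𝓝[>] 0) (𝓝 (-(2 * I / Real.pi))) := by
  have hl : Tendsto (fun y : ℝ => ((Real.log (y / 2) * y : ℝ) : ℂ)) (𝓝[>] 0) (𝓝 ((0 : ℝ) : ℂ)) :=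
    (Complex.continuous_ofReal.tendsto 0).comp tendsto_log_half_mul
  have hid : Tendsto (fun y : ℝ => (y : ℂ)) (𝓝[>] 0) (𝓝 ((0 : ℝ) : ℂ)) :=
    (Complex.continuous_ofReal.tendsto 0).mono_left nhdsWithin_le_nhds
  have hA := tendsto_comp_neg_sq (continuous_besA 1).continuousAt
  have hB := tendsto_comp_neg_sq (continuous_besB 1).continuousAt
  have h := (((hl.mul hid).mul hA).const_mul (-(I / Real.pi) : ℂ)).add
    (((hid.mul hid).mul hB).const_mul (I / (2 * Real.pi) : ℂ)) |>.add_const (-(2 * I / Real.pi))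
  simp only [ofReal_zero, mul_zero, zero_mul, add_zero, zero_add] at h
  refine h.congr' ?_
  filter_upwards [self_mem_nhdsWithin] with y hy
  have hy' : (y : ℂ) ≠ 0 := by exact_mod_cast (ne_of_gt (show 0 < y from hy))
  have hpi : (Real.pi : ℂ) ≠ 0 := by exact_mod_cast Real.pi_ne_zero
  rw [hankelH_eq, logNegImCut_I_mul_half hy]
  have : besP 1 ((I * (y : ℂ)) ^ 2 / 4) = 1 := by simp [besP]
  rw [this]
  push_cast
  field_simp
  ring_nf
  simp only [I_sq, show I ^ 3 = -I from I_pow_three]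
  ring

/-! ### Identification of `H_0` with its integral representation. -/

/-- The difference between `H_0` and its integral representation. -/
def hankelDiff (z : ℂ) : ℂ := hankelH 0 z + 2 * I / Real.pi * besG 0 z

/-- `z` times the derivative of `hankelDiff`. -/
def hankelDiffFlux (z : ℂ) : ℂ := -(z * hankelH 1 z) + 2 * I / Real.pi * (I * z * besG 1 z)

theorem hasDerivAt_hankelDiff {z : ℂ} (hz : 0 < z.im) :
    HasDerivAt hankelDiff (hankelDiffFlux z / z) z := by
  have hz0 : z ≠ 0 := by rintro rfl; simp at hz
  refine ((hasDerivAt_hankelH 0 hz).add ((hasDerivAt_besG 0 hz).const_mul _)).congr_deriv ?_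
  rw [hankelDiffFlux]
  push_cast
  field_simp
  ring

/-- This is Bessel's equation of order zero in the form `(z D')' = -z D`. -/
theorem hasDerivAt_hankelDiffFlux {z : ℂ} (hz : 0 < z.im) :
    HasDerivAt hankelDiffFlux (-(z * hankelDiff z)) z := by
  have hz0 : z ≠ 0 := by rintro rfl; simp at hz
  have h := ((hasDerivAt_id z).mul (hasDerivAt_hankelH_succ 0 hz)).neg.add
    ((((hasDerivAt_id z).const_mul I).mul (hasDerivAt_besG 1 hz)).const_mul (2 * I / Real.pi : ℂ))
  refine h.congr_deriv ?_
  have hb := besG_bessel hz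
  rw [hankelDiff]
  simp only [id, zero_add, Nat.cast_zero]
  have e : z * (hankelH 0 z - 1 / z * hankelH 1 z) = z * hankelH 0 z - hankelH 1 z := by
    field_simp
  linear_combination -e + (2 * I / Real.pi) * I * hb
    + (2 * I / Real.pi) * (z * besG 0 z) * I_mul_I

theorem isOpen_upperHalfPlane : IsOpen {z : ℂ | 0 < z.im} :=
  isOpen_lt continuous_const Complex.continuous_im

theorem convex_upperHalfPlane : Convex ℝ {z : ℂ | 0 < z.im} := convex_halfSpace_im_gt 0

theorem tendsto_hankelDiff : Tendsto (fun y : ℝ => hankelDiff (I * y)) (𝓝[>] 0) (𝓝 0) := by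
  have h1 := (Complex.continuous_ofReal.tendsto _).comp tendsto_coshIntegral_zero_add_log
  have h := tendsto_hankelH_zero_sub_log.add (h1.const_mul (2 * I / Real.pi : ℂ))
  have e : 2 * I / Real.pi * (Real.eulerMascheroniConstant : ℂ) + 2 * I / Real.pi *
    ((-Real.eulerMascheroniConstant : ℝ) : ℂ) = 0 := by push_cast; ring
  rw [e] at h
  refine h.congr fun y => ?_
  rw [hankelDiff, besG_I_mul]
  simp only [Function.comp, ofReal_add]
  ring

theorem tendsto_hankelDiffFlux :
    Tendsto (fun y : ℝ => hankelDiffFlux (I * y)) (𝓝[>] 0) (𝓝 0) := by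
  have h1 := (Complex.continuous_ofReal.tendsto _).comp tendsto_mul_coshIntegral_one
  have h := tendsto_mul_hankelH_one.neg.sub (h1.const_mul (2 * I / Real.pi : ℂ))
  rw [ofReal_one, mul_one, neg_neg, sub_self] at h
  refine h.congr fun y => ?_
  rw [hankelDiffFlux, besG_I_mul]
  simp only [Function.comp, ofReal_mul]
  linear_combination -(2 * I / Real.pi) * ((y : ℂ) * coshIntegral 1 y) * I_mul_I

/-- The Wronskian of `hankelDiff` and `J_0` vanishes. -/
theorem hankelDiff_wronskian {z : ℂ} (hz : 0 < z.im) :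
    hankelDiffFlux z * besA 0 (z ^ 2 / 4) + hankelDiff z * (z ^ 2 / 2 * besA 1 (z ^ 2 / 4)) = 0 := by
  -- This is `z (D' J_0 - D J_0')` with `J_0' = -(z / 2) besA 1 (z ^ 2 / 4)`. Being constant on the
  -- half-plane, it equals its limit at the origin.
  set W : ℂ → ℂ := fun z =>
    hankelDiffFlux z * besA 0 (z ^ 2 / 4) + hankelDiff z * (z ^ 2 / 2 * besA 1 (z ^ 2 / 4))
  have hsq : ∀ z : ℂ, HasDerivAt (fun z : ℂ => z ^ 2 / 4) (z / 2) z := fun z =>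
    ((hasDerivAt_pow 2 z).div_const 4).congr_deriv (by push_cast; ring)
  have hW : ∀ z ∈ {z : ℂ | 0 < z.im}, HasDerivAt W 0 z := by
    intro z hz
    have hz0 : z ≠ 0 := by rintro rfl; simp at hz
    have hA0 := (hasDerivAt_besA 0 (z ^ 2 / 4)).comp z (hsq z)
    have hA1 := (hasDerivAt_besA 1 (z ^ 2 / 4)).comp z (hsq z)
    have hs : HasDerivAt (fun z : ℂ => z ^ 2 / 2) z z :=
      ((hasDerivAt_pow 2 z).div_const 2).congr_deriv (by push_cast; ring)
    refine (((hasDerivAt_hankelDiffFlux hz).mul hA0).add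
      ((hasDerivAt_hankelDiff hz).mul (hs.mul hA1))).congr_deriv ?_
    have hr := besA_recurrence 0 (z ^ 2 / 4)
    simp only [Function.comp, Pi.mul_apply, Nat.cast_zero, zero_add, one_mul] at hr ⊢
    rw [← hr]
    field_simp
    ring
  have hconst : ∀ y : ℝ, 0 < y → W (I * y) = W z := by
    intro y hy
    refine isOpen_upperHalfPlane.is_const_of_deriv_eq_zero
      convex_upperHalfPlane.isPreconnected
      (fun w hw => (hW w hw).differentiableAt.differentiableWithinAt)
      (fun w hw => (hW w hw).deriv) ?_ hz
    simpa using hy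
  have hid : Tendsto (fun y : ℝ => (I * (y : ℂ)) ^ 2 / 2) (𝓝[>] 0) (𝓝 0) := by
    have : Tendsto (fun y : ℝ => (I * (y : ℂ)) ^ 2 / 2) (𝓝 0)
        (𝓝 ((I * ((0 : ℝ) : ℂ)) ^ 2 / 2)) := Continuous.tendsto (by fun_prop) 0
    simp only [ofReal_zero, mul_zero, ne_eq, OfNat.ofNat_ne_zero, not_false_eq_true, zero_pow,
      zero_div] at this
    exact this.mono_left nhdsWithin_le_nhds
  have hlim : Tendsto (fun y : ℝ => W (I * y)) (𝓝[>] 0) (𝓝 0) := by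
    have := (tendsto_hankelDiffFlux.mul
      (tendsto_comp_neg_sq (continuous_besA 0).continuousAt)).add
      (tendsto_hankelDiff.mul (hid.mul (tendsto_comp_neg_sq (continuous_besA 1).continuousAt)))
    simpa using this
  refine tendsto_nhds_unique (tendsto_const_nhds.congr' ?_) hlim
  filter_upwards [self_mem_nhdsWithin] with y hy using (hconst y hy).symm

/-- By the Wronskian, `D / J_0` is constant near the origin, where `J_0` has no zeros, and its limit
there is `0`. The identity theorem removes the restriction to small `z`. -/
theorem hankelDiff_eq_zero {z : ℂ} (hz : 0 < z.im) : hankelDiff z = 0 := by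
  have hc : ContinuousAt (fun z : ℂ => besA 0 (z ^ 2 / 4)) 0 :=
    ((continuous_besA 0).comp (by fun_prop)).continuousAt
  have hne : ∀ᶠ z in 𝓝 (0 : ℂ), besA 0 (z ^ 2 / 4) ≠ 0 :=
    hc.eventually_ne (by simp [besA_zero_zero])
  obtain ⟨ε, hε, hball⟩ := Metric.eventually_nhds_iff_ball.1 hne
  set S : Set ℂ := {z : ℂ | 0 < z.im} ∩ Metric.ball 0 ε
  have hSo : IsOpen S := isOpen_upperHalfPlane.inter Metric.isOpen_ball
  have hSc : IsPreconnected S :=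
    (convex_upperHalfPlane.inter (convex_ball _ _)).isPreconnected
  have hsq : ∀ z : ℂ, HasDerivAt (fun z : ℂ => z ^ 2 / 4) (z / 2) z := fun z =>
    ((hasDerivAt_pow 2 z).div_const 4).congr_deriv (by push_cast; ring)
  have hQ : ∀ z ∈ S, HasDerivAt (fun z => hankelDiff z / besA 0 (z ^ 2 / 4)) 0 z := by
    intro z hz
    have hz0 : z ≠ 0 := by rintro rfl; simpa using hz.1
    have hA : besA 0 (z ^ 2 / 4) ≠ 0 := hball z hz.2
    have hA0 := (hasDerivAt_besA 0 (z ^ 2 / 4)).comp z (hsq z)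
    refine ((hasDerivAt_hankelDiff hz.1).div hA0 hA).congr_deriv ?_
    have hw := hankelDiff_wronskian hz.1
    simp only [Function.comp, zero_add]
    field_simp
    linear_combination 2 * hw
  have hevS : ∀ᶠ y : ℝ in 𝓝[>] 0, I * (y : ℂ) ∈ S := by
    filter_upwards [Ioo_mem_nhdsGT hε] with y hy
    refine ⟨by simpa using hy.1, ?_⟩
    rw [mem_ball_zero_iff, norm_mul, norm_I, one_mul, Complex.norm_real,
      Real.norm_of_nonneg hy.1.le]
    exact hy.2
  have hlim : Tendsto (fun y : ℝ => hankelDiff (I * y) / besA 0 ((I * y) ^ 2 / 4)) (𝓝[>] 0)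
      (𝓝 0) := by
    have := tendsto_hankelDiff.div (tendsto_comp_neg_sq (continuous_besA 0).continuousAt)
      (by simp [besA_zero_zero])
    rwa [zero_div] at this
  have hS0 : ∀ w ∈ S, hankelDiff w = 0 := by
    intro w hw
    have : hankelDiff w / besA 0 (w ^ 2 / 4) = 0 := by
      refine tendsto_nhds_unique (tendsto_const_nhds.congr' ?_) hlim
      filter_upwards [hevS] with y hy
      exact hSo.is_const_of_deriv_eq_zero hSc
        (fun w hw => (hQ w hw).differentiableAt.differentiableWithinAt)
        (fun w hw => (hQ w hw).deriv) hw hy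
    exact (div_eq_zero_iff.1 this).resolve_right (hball w hw.2)
  obtain ⟨y, hy⟩ := hevS.exists
  have han : AnalyticOnNhd ℂ hankelDiff {z : ℂ | 0 < z.im} :=
    DifferentiableOn.analyticOnNhd
      (fun w hw => (hasDerivAt_hankelDiff hw).differentiableAt.differentiableWithinAt)
      isOpen_upperHalfPlane
  refine han.eqOn_zero_of_preconnected_of_eventuallyEq_zero
    convex_upperHalfPlane.isPreconnected hy.1 ?_ hz
  filter_upwards [hSo.mem_nhds hy] with w hw using hS0 w hw

/-- Integral representation of `H_0` in the upper half-plane. -/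
theorem hankelH_zero_eq {z : ℂ} (hz : 0 < z.im) :
    hankelH 0 z = -(2 * I / Real.pi) * besG 0 z := by
  have := hankelDiff_eq_zero hz
  rw [hankelDiff] at this
  linear_combination this

theorem hankelH_one_eq {z : ℂ} (hz : 0 < z.im) :
    hankelH 1 z = -(2 / Real.pi) * besG 1 z := by
  have hz0 : z ≠ 0 := by rintro rfl; simp at hz
  have h1 := (hasDerivAt_hankelH 0 hz).congr_of_eventuallyEq
    (f₁ := fun z => -(2 * I / Real.pi) * besG 0 z) (by
      filter_upwards [isOpen_upperHalfPlane.mem_nhds hz] with w hw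
      exact (hankelH_zero_eq hw).symm)
  have := h1.unique ((hasDerivAt_besG 0 hz).const_mul _)
  simp only [Nat.cast_zero, zero_div, zero_mul, zero_add] at this
  linear_combination -this + (2 / Real.pi) * besG 1 z * I_mul_I

/-! ### Decay and non-vanishing of the Hankel functions. -/

/-- Exponential decay of all `H_n` away from the real axis. -/
theorem exists_norm_hankelH_le (n : ℕ) : ∃ C : ℝ, ∀ z : ℂ, 1 ≤ z.im →
    ‖hankelH n z‖ ≤ C * Real.exp (-z.im) ∧ ‖hankelH (n + 1) z‖ ≤ C * Real.exp (-z.im) := by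
  induction n with
  | zero =>
    set c : ℝ := Real.exp 1 * coshIntegral 0 1
    set d : ℝ := Real.exp 1 * coshIntegral 1 1
    refine ⟨max (‖-(2 * I / Real.pi : ℂ)‖ * c) (‖-(2 / Real.pi : ℂ)‖ * d), fun z hz => ?_⟩
    have hz' : 0 < z.im := by linarith
    constructor
    · rw [hankelH_zero_eq hz', norm_mul]
      calc _ ≤ ‖-(2 * I / Real.pi : ℂ)‖ * (c * Real.exp (-z.im)) := by
            gcongr; exact norm_besG_le 0 hz
        _ = ‖-(2 * I / Real.pi : ℂ)‖ * c * Real.exp (-z.im) := by ring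
        _ ≤ _ := by gcongr; exact le_max_left _ _
    · rw [zero_add, hankelH_one_eq hz', norm_mul]
      calc _ ≤ ‖-(2 / Real.pi : ℂ)‖ * (d * Real.exp (-z.im)) := by
            gcongr; exact norm_besG_le 1 hz
        _ = ‖-(2 / Real.pi : ℂ)‖ * d * Real.exp (-z.im) := by ring
        _ ≤ _ := by gcongr; exact le_max_right _ _
  -- Two consecutive orders are bounded together so that the three-term recurrence closes the
  -- induction; `‖z‖ ≥ 1` controls its coefficient.
  | succ n ih =>
    obtain ⟨C, hC⟩ := ih
    refine ⟨(2 * (n + 1) + 1) * C, fun z hz => ?_⟩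
    have hz0 : z ≠ 0 := by rintro rfl; norm_num at hz
    obtain ⟨h0, h1⟩ := hC z hz
    have hCe : 0 ≤ C * Real.exp (-z.im) := (norm_nonneg _).trans h0
    have hn : (0 : ℝ) ≤ n := Nat.cast_nonneg n
    have h1z : 1 ≤ ‖z‖ := hz.trans ((le_abs_self _).trans (Complex.abs_im_le_norm z))
    constructor
    · nlinarith [mul_nonneg hn hCe]
    · have e : hankelH (n + 1 + 1) z
          = 2 * ((n + 1 : ℕ) : ℂ) / z * hankelH (n + 1) z - hankelH n z := by
        have := hankelH_three_term n hz0
        push_cast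
        linear_combination -this
      have hc : ‖2 * ((n + 1 : ℕ) : ℂ) / z‖ ≤ 2 * (n + 1) := by
        rw [norm_div, norm_mul, Complex.norm_natCast, Complex.norm_ofNat]
        push_cast
        exact div_le_self (by positivity) h1z
      rw [e]
      refine (norm_sub_le _ _).trans ?_
      rw [norm_mul]
      have : ‖2 * ((n + 1 : ℕ) : ℂ) / z‖ * ‖hankelH (n + 1) z‖ ≤
          2 * (n + 1) * (C * Real.exp (-z.im)) := by gcongr
      linarith

/-- No `H_n` vanishes on the end of a ray in the upper half-plane. -/
theorem hankelH_not_vanish_ray (n : ℕ) {k : ℂ} (hk : 0 < k.im) (R : ℝ)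
    (hR : ∀ r : ℝ, R < r → hankelH n (k * r) = 0) : False := by
  induction n generalizing R with
  | zero =>
    have hk0 : k ≠ 0 := by rintro rfl; simp at hk
    have han : AnalyticOnNhd ℂ (hankelH 0) {z : ℂ | 0 < z.im} :=
      DifferentiableOn.analyticOnNhd
        (fun w hw => (hasDerivAt_hankelH 0 hw).differentiableAt.differentiableWithinAt)
        isOpen_upperHalfPlane
    set ρ : ℝ := max R 0 + 1
    have hρR : R < ρ := by have := le_max_left R 0; simp only [ρ]; linarith
    have hρ0 : 0 < ρ := by have := le_max_right R 0; simp only [ρ]; linarith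
    have hmem : k * (ρ : ℂ) ∈ {z : ℂ | 0 < z.im} := by
      simp only [mem_ofPred_eq, Complex.mul_im, ofReal_re, ofReal_im, mul_zero, zero_add]
      positivity
    -- The zeros accumulate at `k ρ`, so `H_0` would vanish identically, against the positivity of
    -- its integral at `z = i`.
    have hfreq : ∃ᶠ z in 𝓝[≠] (k * (ρ : ℂ)), hankelH 0 z = 0 := by
      have ht : Tendsto (fun r : ℝ => k * (r : ℂ)) (𝓝[>] ρ) (𝓝[≠] (k * (ρ : ℂ))) := by
        refine tendsto_nhdsWithin_of_tendsto_nhds_of_eventually_within _ ?_ ?_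
        · exact (Continuous.tendsto (by fun_prop) ρ).mono_left nhdsWithin_le_nhds
        · filter_upwards [self_mem_nhdsWithin] with r hr h
          have h' : (r : ℂ) = ρ := mul_left_cancel₀ hk0 h
          exact (ne_of_gt (show ρ < r from hr)) (by exact_mod_cast h')
      refine ht.frequently (Eventually.frequently ?_)
      filter_upwards [self_mem_nhdsWithin] with r hr using hR r (hρR.trans hr)
    have h0 := han.eqOn_zero_of_preconnected_of_frequently_eq_zero
      convex_upperHalfPlane.isPreconnected hmem hfreq
      (show I * ((1 : ℝ) : ℂ) ∈ {z : ℂ | 0 < z.im} by simp)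
    rw [hankelH_zero_eq (by simp), besG_I_mul] at h0
    have hpi : (Real.pi : ℂ) ≠ 0 := by exact_mod_cast Real.pi_ne_zero
    have hc : (coshIntegral 0 1 : ℂ) ≠ 0 := by exact_mod_cast coshIntegral_zero_one_pos.ne'
    simp [hpi, hc] at h0
  | succ n ih =>
    -- If `H_{n+1}` vanishes along the ray, so does its derivative, and the ladder relation leaves
    -- `H_n = 0`.
    refine ih (max R 0) fun r hr => ?_
    have hr0 : 0 < r := (le_max_right R 0).trans_lt hr
    have hk0 : k ≠ 0 := by rintro rfl; simp at hk
    have him : 0 < (k * (r : ℂ)).im := by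
      simp only [Complex.mul_im, ofReal_re, ofReal_im, mul_zero, zero_add]
      positivity
    have hin : HasDerivAt (fun r : ℝ => k * (r : ℂ)) k r := by
      simpa using (hasDerivAt_id r).ofReal_comp.const_mul k
    have h1 : HasDerivAt (fun r : ℝ => hankelH (n + 1) (k * r)) _ r :=
      HasDerivAt.comp_of_eq (h := fun r : ℝ => k * (r : ℂ)) r
        (hasDerivAt_hankelH_succ n him) hin rfl
    have h2 : HasDerivAt (fun r : ℝ => hankelH (n + 1) (k * r)) 0 r := by
      refine (hasDerivAt_const r (0 : ℂ)).congr_of_eventuallyEq ?_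
      filter_upwards [Ioi_mem_nhds ((le_max_left R 0).trans_lt hr)] with t ht using hR t ht
    have h3 := h1.unique h2
    rw [hR r ((le_max_left R 0).trans_lt hr), mul_zero, sub_zero] at h3
    exact (mul_eq_zero.1 h3).resolve_right hk0

/-! ### Linear differential equations with holomorphic parameters. -/

/-- A Neumann series argument: the equation `g + (T₀ + μ T₁) g = x` has a solution which depends
holomorphically on `μ` and `x`. -/
theorem exists_holomorphic_resolvent {X : Type*} [NormedAddCommGroup X] [NormedSpace ℂ X]
    [CompleteSpace X] (T₀ T₁ : X →L[ℂ] X) {R : ℝ} (hT : ‖T₀‖ + |R| * ‖T₁‖ < 1) :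
    ∃ g : ℂ → X → X, (∀ μ, ‖μ‖ < R → ∀ x, g μ x = x - (T₀ (g μ x) + μ • T₁ (g μ x))) ∧
      ∀ (μ : ℂ → ℂ) (x : ℂ → X) (k : ℂ), ‖μ k‖ < R → DifferentiableAt ℂ μ k →
        DifferentiableAt ℂ x k → DifferentiableAt ℂ (fun k => g (μ k) (x k)) k := by
  have hunit : ∀ μ : ℂ, ‖μ‖ < R → IsUnit (1 - -(T₀ + μ • T₁)) := by
    intro μ hμ
    refine isUnit_one_sub_of_norm_lt_one (lt_of_le_of_lt ?_ hT)
    rw [norm_neg]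
    refine (norm_add_le _ _).trans ?_
    rw [norm_smul]
    gcongr
    exact hμ.le.trans (le_abs_self R)
  refine ⟨fun μ x => Ring.inverse (1 - -(T₀ + μ • T₁)) x, fun μ hμ x => ?_,
    fun μ x k hμk hμ hx => ?_⟩
  · have h := DFunLike.congr_fun (Ring.mul_inverse_cancel _ (hunit μ hμ)) x
    simp only [sub_neg_eq_add, one_apply_eq_self] at h ⊢
    exact eq_sub_of_add_eq h
  · have hTd : DifferentiableAt ℂ (fun k => 1 - -(T₀ + μ k • T₁)) k :=
      (((hμ.smul_const T₁).const_add _).neg).const_sub 1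
    exact ((differentiableAt_inverse (𝕜 := ℂ) (hunit _ hμk)).comp k hTd).clm_apply hx

theorem differentiableAt_clm_comp {X E : Type*} [NormedAddCommGroup X] [NormedSpace ℂ X]
    [NormedAddCommGroup E] [NormedSpace ℂ E] (L : X →L[ℂ] E) {f : ℂ → X} {k : ℂ}
    (hf : DifferentiableAt ℂ f k) : DifferentiableAt ℂ (fun k => L (f k)) k :=
  L.differentiableAt.comp k hf

section LinearODE

variable {E : Type*} [NormedAddCommGroup E] [NormedSpace ℂ E] {c d : ℝ}

/-- The value at `r` of the exponentially weighted Volterra integral of `f`. -/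
def volterraFun (hcd : c ≤ d) (l : ℝ) (A : ℝ → E →L[ℂ] E) (f : C(Icc c d, E)) (r : ℝ) : E :=
  Real.exp (l * r) • ∫ t in r..d, Real.exp (-(l * t)) • A t (IccExtend hcd f t)

theorem continuous_volterra_integrand (hcd : c ≤ d) (l : ℝ) {A : ℝ → E →L[ℂ] E}
    (hA : Continuous A) (f : C(Icc c d, E)) :
    Continuous fun t => Real.exp (-(l * t)) • A t (IccExtend hcd f t) := by
  have h : Continuous (IccExtend hcd f) := f.continuous.Icc_extend'
  exact (by fun_prop : Continuous fun t => Real.exp (-(l * t))).smul (hA.clm_apply h)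

theorem continuous_integral_left {g : ℝ → E} (hg : Continuous g) (d : ℝ) :
    Continuous fun r => ∫ t in r..d, g t := by
  simp_rw [intervalIntegral.integral_symm d]
  exact (intervalIntegral.continuous_primitive (fun a b => hg.intervalIntegrable a b) d).neg

/-- The weight turns the kernel into `exp(-l (t - r))`, of integral at most `1 / l`. A large `l`
thus gives a small norm on an interval of any length. -/
theorem norm_volterraFun_le (hcd : c ≤ d) {l M : ℝ} (hl : 0 < l) (A : ℝ → E →L[ℂ] E)
    (hM : ∀ t ∈ Icc c d, ‖A t‖ ≤ M) (f : C(Icc c d, E)) {r : ℝ} (hr : r ∈ Icc c d) :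
    ‖volterraFun hcd l A f r‖ ≤ M / l * ‖f‖ := by
  have hM0 : 0 ≤ M := (norm_nonneg _).trans (hM r hr)
  have hint : ∫ t in r..d, M * ‖f‖ * Real.exp (-(l * t)) =
      M * ‖f‖ * ((Real.exp (-(l * r)) - Real.exp (-(l * d))) / l) := by
    rw [intervalIntegral.integral_const_mul]
    congr 1
    rw [intervalIntegral.integral_eq_sub_of_hasDerivAt
      (f := fun t => -(Real.exp (-(l * t)) / l))]
    · ring
    · intro t _
      refine (((hasDerivAt_id t).const_mul l).neg.exp.div_const l).neg.congr_deriv ?_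
      simp only [Pi.neg_apply, id]
      field_simp
    · exact (by fun_prop : Continuous fun t => Real.exp (-(l * t))).intervalIntegrable _ _
  have h1 : ‖∫ t in r..d, Real.exp (-(l * t)) • A t (IccExtend hcd f t)‖ ≤
      ∫ t in r..d, M * ‖f‖ * Real.exp (-(l * t)) := by
    refine intervalIntegral.norm_integral_le_of_norm_le hr.2
      (Eventually.of_forall fun t ht => ?_)
      ((by fun_prop : Continuous fun t => M * ‖f‖ * Real.exp (-(l * t))).intervalIntegrable _ _)
    rw [norm_smul, Real.norm_of_nonneg (Real.exp_pos _).le, mul_comm]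
    gcongr
    refine ((A t).le_opNorm _).trans ?_
    have ht' : t ∈ Icc c d := ⟨hr.1.trans ht.1.le, ht.2⟩
    exact mul_le_mul (hM t ht') (f.norm_coe_le_norm _) (norm_nonneg _) hM0
  rw [hint] at h1
  rw [volterraFun, norm_smul, Real.norm_of_nonneg (Real.exp_pos _).le]
  have h2 : Real.exp (l * r) * Real.exp (-(l * r)) = 1 := by
    rw [← Real.exp_add]; simp
  have h3 := Real.exp_pos (l * r)
  have h4 := Real.exp_pos (-(l * d))
  calc _ ≤ Real.exp (l * r) *
        (M * ‖f‖ * ((Real.exp (-(l * r)) - Real.exp (-(l * d))) / l)) := by gcongr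
    _ ≤ Real.exp (l * r) * (M * ‖f‖ * (Real.exp (-(l * r)) / l)) := by
        gcongr; linarith
    _ = Real.exp (l * r) * Real.exp (-(l * r)) * (M / l * ‖f‖) := by ring
    _ = _ := by rw [h2, one_mul]

/-- The exponentially weighted Volterra operator. -/
def volterra (hcd : c ≤ d) {l M : ℝ} (hl : 0 < l) {A : ℝ → E →L[ℂ] E} (hA : Continuous A)
    (hM : ∀ t ∈ Icc c d, ‖A t‖ ≤ M) : C(Icc c d, E) →L[ℂ] C(Icc c d, E) :=
  LinearMap.mkContinuous
    { toFun := fun f => ⟨fun r => volterraFun hcd l A f r,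
        ((by fun_prop : Continuous fun r => Real.exp (l * r)).smul (continuous_integral_left
          (continuous_volterra_integrand hcd l hA f) d)).comp continuous_subtype_val⟩
      map_add' := fun f g => by
        ext r
        change volterraFun hcd l A (f + g) r = volterraFun hcd l A f r + volterraFun hcd l A g r
        rw [volterraFun, volterraFun, volterraFun, ← smul_add, ← intervalIntegral.integral_add
          ((continuous_volterra_integrand hcd l hA f).intervalIntegrable _ _)
          ((continuous_volterra_integrand hcd l hA g).intervalIntegrable _ _)]
        simp [IccExtend]
      map_smul' := fun a f => by
        ext r
        change volterraFun hcd l A (a • f) r = a • volterraFun hcd l A f r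
        rw [volterraFun, volterraFun, smul_comm a, ← intervalIntegral.integral_smul a]
        simp only [IccExtend, Function.comp, ContinuousMap.smul_apply, map_smul,
          smul_comm _ a (_ : E)] }
    (M / l) fun f => by
      have hM0 : 0 ≤ M := (norm_nonneg _).trans (hM c ⟨le_rfl, hcd⟩)
      exact (ContinuousMap.norm_le _ (by positivity)).2 fun r =>
        norm_volterraFun_le hcd hl A hM f r.2

theorem norm_volterra_le (hcd : c ≤ d) {l M : ℝ} (hl : 0 < l) {A : ℝ → E →L[ℂ] E}
    (hA : Continuous A) (hM : ∀ t ∈ Icc c d, ‖A t‖ ≤ M) : ‖volterra hcd hl hA hM‖ ≤ M / l := by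
  have hM0 : 0 ≤ M := (norm_nonneg _).trans (hM c ⟨le_rfl, hcd⟩)
  exact LinearMap.mkContinuous_norm_le _ (by positivity) _

/-- The terminal value `v`, weighted by `exp (-l (d - r))`. -/
def weightedConst (E : Type*) [NormedAddCommGroup E] [NormedSpace ℂ E] (c d l : ℝ) :
    E →L[ℂ] C(Icc c d, E) :=
  LinearMap.mkContinuous
    { toFun := fun v => ⟨fun r => Real.exp (-(l * (d - r))) • v, by fun_prop⟩
      map_add' := fun v w => by ext r; simp
      map_smul' := fun a v => by
        ext r
        change Real.exp (-(l * (d - r))) • a • v = a • Real.exp (-(l * (d - r))) • v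
        rw [smul_comm] }
    (Real.exp (|l| * (d - c))) fun v => by
      refine (ContinuousMap.norm_le _ (by positivity)).2 fun r => ?_
      change ‖Real.exp (-(l * (d - r))) • v‖ ≤ _
      rw [norm_smul, Real.norm_of_nonneg (Real.exp_pos _).le]
      have h1 : 0 ≤ d - (r : ℝ) := sub_nonneg.2 r.2.2
      have h2 : d - (r : ℝ) ≤ d - c := by linarith [r.2.1]
      have h3 : -l * (d - r) ≤ |l| * (d - c) :=
        (mul_le_mul_of_nonneg_right (neg_le_abs l) h1).trans
          (mul_le_mul_of_nonneg_left h2 (abs_nonneg l))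
      gcongr
      linarith

theorem weightedConst_apply (l : ℝ) (v : E) (r : Icc c d) :
    weightedConst E c d l v r = Real.exp (-(l * (d - r))) • v := rfl

variable [CompleteSpace E]

/-- Solutions of `y' = (A₀ + μ A₁) y` with prescribed value at the right end point of an
interval exist and depend holomorphically on `μ` and the prescribed value. -/
theorem exists_linear_ode_solution (hcd : c ≤ d) {A₀ A₁ : ℝ → E →L[ℂ] E} (h₀ : Continuous A₀)
    (h₁ : Continuous A₁) (R : ℝ) :
    ∃ Φ : ℂ → E → ℝ → E,
      (∀ μ, ‖μ‖ < R → ∀ v, Φ μ v d = v ∧ ∀ r ∈ Icc c d,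
        HasDerivAt (Φ μ v) (A₀ r (Φ μ v r) + μ • A₁ r (Φ μ v r)) r) ∧
      ∀ (μ : ℂ → ℂ) (v : ℂ → E) (k : ℂ), ‖μ k‖ < R → DifferentiableAt ℂ μ k →
        DifferentiableAt ℂ v k → ∀ r ∈ Icc c d,
          DifferentiableAt ℂ (fun k => Φ (μ k) (v k) r) k := by
  obtain ⟨M₀, hM₀⟩ := isCompact_Icc.exists_bound_of_continuousOn (s := Icc c d) h₀.continuousOn
  obtain ⟨M₁, hM₁⟩ := isCompact_Icc.exists_bound_of_continuousOn (s := Icc c d) h₁.continuousOn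
  have hM₀0 : 0 ≤ M₀ := (norm_nonneg _).trans (hM₀ c ⟨le_rfl, hcd⟩)
  have hM₁0 : 0 ≤ M₁ := (norm_nonneg _).trans (hM₁ c ⟨le_rfl, hcd⟩)
  set l : ℝ := M₀ + |R| * M₁ + 1
  have hl : 0 < l := by positivity
  have hT : ‖volterra hcd hl h₀ hM₀‖ + |R| * ‖volterra hcd hl h₁ hM₁‖ < 1 :=
    calc _ ≤ M₀ / l + |R| * (M₁ / l) := by
          gcongr <;> exact norm_volterra_le _ _ _ _
      _ = (M₀ + |R| * M₁) / l := by ring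
      _ < 1 := by rw [div_lt_one hl]; simp [l]
  obtain ⟨g₀, hg₀, hgd₀⟩ := exists_holomorphic_resolvent _ _ hT
  set g : ℂ → E → C(Icc c d, E) := fun μ v => g₀ μ (weightedConst E c d l v)
  -- Removes the weight; the constant extension beyond `[c, d]` makes `y` continuous on the line,
  -- though not a solution there.
  set y : ℂ → E → ℝ → E := fun μ v r => Real.exp (l * (d - r)) • IccExtend hcd (g μ v) r
  have hyc : ∀ μ v, Continuous (y μ v) := fun μ v =>
    (by fun_prop : Continuous fun r => Real.exp (l * (d - r))).smul
      (g μ v).continuous.Icc_extend'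
  set G : ℂ → E → ℝ → E := fun μ v t => A₀ t (y μ v t) + μ • A₁ t (y μ v t)
  have hGc : ∀ μ v, Continuous (G μ v) := fun μ v =>
    (h₀.clm_apply (hyc μ v)).add ((h₁.clm_apply (hyc μ v)).const_smul μ)
  have hV : ∀ {A : ℝ → E →L[ℂ] E} (f : C(Icc c d, E)) (r : ℝ),
      Real.exp (l * (d - r)) • volterraFun hcd l A f r =
        ∫ t in r..d, A t (Real.exp (l * (d - t)) • IccExtend hcd f t) := by
    intro A f r
    rw [volterraFun, smul_smul, ← intervalIntegral.integral_smul]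
    refine intervalIntegral.integral_congr fun t _ => ?_
    rw [smul_smul, ← Real.exp_add, ← Real.exp_add, ← Complex.coe_smul, ← Complex.coe_smul,
      map_smul]
    congr 3
    ring
  have hy : ∀ μ, ‖μ‖ < R → ∀ v, ∀ r ∈ Icc c d, v - ∫ t in r..d, G μ v t = y μ v r := by
    intro μ hμ v r hr
    have h1 : g μ v ⟨r, hr⟩ = weightedConst E c d l v ⟨r, hr⟩ -
        (volterraFun hcd l A₀ (g μ v) r + μ • volterraFun hcd l A₁ (g μ v) r) :=
      DFunLike.congr_fun (hg₀ μ hμ (weightedConst E c d l v)) ⟨r, hr⟩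
    rw [weightedConst_apply] at h1
    have h3 : y μ v r = Real.exp (l * (d - r)) • g μ v ⟨r, hr⟩ := by
      simp only [y, IccExtend_of_mem hcd _ hr]
    rw [h3, h1, smul_sub, smul_smul, ← Real.exp_add, smul_add, smul_comm _ μ, hV, hV]
    have hadd : ∫ t in r..d, G μ v t =
        (∫ t in r..d, A₀ t (y μ v t)) + μ • ∫ t in r..d, A₁ t (y μ v t) := by
      rw [← intervalIntegral.integral_smul]
      exact intervalIntegral.integral_add ((h₀.clm_apply (hyc μ v)).intervalIntegrable _ _)
        (((h₁.clm_apply (hyc μ v)).const_smul μ).intervalIntegrable _ _)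
    rw [hadd]
    simp [y]
  -- The integral formula is chosen over `y` because it has two-sided derivatives at the end points
  -- too.
  refine ⟨fun μ v r => v - ∫ t in r..d, G μ v t, fun μ hμ v => ⟨by simp, fun r hr => ?_⟩,
    fun μ v k hμk hμ hv r hr => ?_⟩
  · simp only [hy μ hμ v r hr]
    have h := intervalIntegral.integral_hasDerivAt_left ((hGc μ v).intervalIntegrable r d)
      ((hGc μ v).stronglyMeasurableAtFilter _ _) (hGc μ v).continuousAt
    refine (h.const_sub v).congr_deriv ?_
    rw [neg_neg]
  · have hgd : DifferentiableAt ℂ (fun k => g (μ k) (v k)) k :=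
      hgd₀ μ _ k hμk hμ ((weightedConst E c d l).differentiableAt.comp k hv)
    have hev : DifferentiableAt ℂ (fun k => g (μ k) (v k) ⟨r, hr⟩) k :=
      differentiableAt_clm_comp (ContinuousMap.evalCLM ℂ (⟨r, hr⟩ : Icc c d)) hgd
    refine (hev.const_smul (Real.exp (l * (d - r)))).congr_of_eventuallyEq ?_
    have hnear : ∀ᶠ k' in 𝓝 k, ‖μ k'‖ < R :=
      (hμ.continuousAt.norm).eventually_lt continuousAt_const hμk
    filter_upwards [hnear] with k' hk'
    simp only [hy _ hk' _ r hr, y, IccExtend_of_mem hcd _ hr, Pi.smul_apply]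

end LinearODE

theorem linear_ode_unique {E : Type*} [NormedAddCommGroup E] [NormedSpace ℂ E]
    {A : ℝ → E →L[ℂ] E} (hA : Continuous A) {c d : ℝ} {f g : ℝ → E}
    (hf : ∀ t ∈ Icc c d, HasDerivAt f (A t (f t)) t)
    (hg : ∀ t ∈ Icc c d, HasDerivAt g (A t (g t)) t) (hd : f d = g d) : EqOn f g (Icc c d) := by
  obtain ⟨M, hM⟩ := isCompact_Icc.exists_bound_of_continuousOn (s := Icc c d) hA.continuousOn
  refine ODE_solution_unique_of_mem_Icc_left (K := M.toNNReal) (v := fun t x => A t x)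
    (s := fun _ => univ) (fun t ht => ?_)
    (fun t ht => (hf t ht).continuousAt.continuousWithinAt)
    (fun t ht => (hf t (Ioc_subset_Icc_self ht)).hasDerivWithinAt) (fun _ _ => trivial)
    (fun t ht => (hg t ht).continuousAt.continuousWithinAt)
    (fun t ht => (hg t (Ioc_subset_Icc_self ht)).hasDerivWithinAt) (fun _ _ => trivial) hd
  refine ((A t).lipschitz.weaken ?_).lipschitzOnWith
  rw [← NNReal.coe_le_coe, coe_nnnorm]
  exact (hM t (Ioc_subset_Icc_self ht)).trans (Real.le_coe_toNNReal M)

/-! ### The outgoing free field. -/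

/-- The derivative of `H_n` in the upper half-plane. -/
def hankelDeriv (n : ℕ) (z : ℂ) : ℂ := n / z * hankelH n z - hankelH (n + 1) z

/-- Bessel's equation for `H_n`. -/
theorem hasDerivAt_hankelDeriv (n : ℕ) {z : ℂ} (hz : 0 < z.im) :
    HasDerivAt (hankelDeriv n)
      ((n ^ 2 / z ^ 2 - 1) * hankelH n z - 1 / z * hankelDeriv n z) z := by
  have hz0 : z ≠ 0 := by rintro rfl; simp at hz
  have h := ((((hasDerivAt_id z).inv hz0).const_mul (n : ℂ)).mul (hasDerivAt_hankelH n hz)).sub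
    (hasDerivAt_hankelH_succ n hz)
  refine (h.congr_of_eventuallyEq (f₁ := hankelDeriv n) ?_).congr_deriv ?_
  · refine Eventually.of_forall fun w => ?_
    simp [hankelDeriv, div_eq_mul_inv]
  · rw [hankelDeriv]
    simp only [id, Pi.inv_apply]
    field_simp
    ring

/-- The outgoing free field `√r H_n(k r)`. -/
def freeField (n : ℕ) (k : ℂ) (r : ℝ) : ℂ := (Real.sqrt r : ℂ) * hankelH n (k * r)

/-- The radial derivative of the outgoing free field. -/
def freeFieldDeriv (n : ℕ) (k : ℂ) (r : ℝ) : ℂ :=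
  1 / (2 * (Real.sqrt r : ℂ)) * hankelH n (k * r) + Real.sqrt r * (k * hankelDeriv n (k * r))

theorem mul_ofReal_im_pos {k : ℂ} (hk : 0 < k.im) {r : ℝ} (hr : 0 < r) :
    0 < (k * (r : ℂ)).im := by
  simp only [Complex.mul_im, ofReal_re, ofReal_im, mul_zero, zero_add]
  positivity

theorem hasDerivAt_ofReal_sqrt {r : ℝ} (hr : 0 < r) :
    HasDerivAt (fun r : ℝ => (Real.sqrt r : ℂ)) (1 / (2 * (Real.sqrt r : ℂ))) r := by
  have := (Real.hasDerivAt_sqrt hr.ne').ofReal_comp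
  exact this.congr_deriv (by push_cast; ring)

theorem hasDerivAt_comp_ray {f : ℂ → ℂ} {f' k : ℂ} {r : ℝ} (hf : HasDerivAt f f' (k * r)) :
    HasDerivAt (fun r : ℝ => f (k * r)) (k * f') r := by
  have hin : HasDerivAt (fun r : ℝ => k * (r : ℂ)) k r := by
    simpa using (hasDerivAt_id r).ofReal_comp.const_mul k
  exact (HasDerivAt.comp_of_eq (h := fun r : ℝ => k * (r : ℂ)) r hf hin rfl).congr_deriv
    (mul_comm _ _)

theorem ofReal_sqrt_mul_self {r : ℝ} (hr : 0 < r) :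
    (Real.sqrt r : ℂ) * (Real.sqrt r : ℂ) = r := by
  exact_mod_cast Real.mul_self_sqrt hr.le

theorem hasDerivAt_freeField (n : ℕ) {k : ℂ} (hk : 0 < k.im) {r : ℝ} (hr : 0 < r) :
    HasDerivAt (freeField n k) (freeFieldDeriv n k r) r :=
  (hasDerivAt_ofReal_sqrt hr).mul
    (hasDerivAt_comp_ray (hasDerivAt_hankelH n (mul_ofReal_im_pos hk hr)))

/-- The factor `√r` removes the first-order term of Bessel's equation, at the price of the `-1/4`.
-/
theorem hasDerivAt_freeFieldDeriv (n : ℕ) {k : ℂ} (hk : 0 < k.im) {r : ℝ} (hr : 0 < r) :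
    HasDerivAt (freeFieldDeriv n k)
      ((((n : ℂ) ^ 2 - 1 / 4) / (r : ℂ) ^ 2 - k ^ 2) * freeField n k r) r := by
  have hk0 : k ≠ 0 := by rintro rfl; simp at hk
  have hs := hasDerivAt_ofReal_sqrt hr
  have hs0 : (Real.sqrt r : ℂ) ≠ 0 := by exact_mod_cast (Real.sqrt_pos.2 hr).ne'
  have hi := ((hs.const_mul 2).inv (mul_ne_zero two_ne_zero hs0))
  have him := mul_ofReal_im_pos hk hr
  have h := (hi.mul (hasDerivAt_comp_ray (hasDerivAt_hankelH n him))).add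
    (hs.mul ((hasDerivAt_comp_ray (hasDerivAt_hankelDeriv n him)).const_mul k))
  refine (h.congr_of_eventuallyEq (f₁ := freeFieldDeriv n k) ?_).congr_deriv ?_
  · refine Eventually.of_forall fun w => ?_
    simp [freeFieldDeriv]
  · rw [freeField, hankelDeriv]
    simp only [Pi.inv_apply]
    have hr2 : (r : ℂ) = (Real.sqrt r : ℂ) ^ 2 := by rw [sq, ofReal_sqrt_mul_self hr]
    generalize hankelH n (k * r) = H₀
    generalize hankelH (n + 1) (k * r) = H₁
    rw [hr2]
    field_simp
    ring

theorem differentiableAt_freeField (n : ℕ) {k : ℂ} (hk : 0 < k.im) {r : ℝ} (hr : 0 < r) :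
    DifferentiableAt ℂ (fun k => freeField n k r) k := by
  have h := (hasDerivAt_hankelH n (mul_ofReal_im_pos hk hr)).differentiableAt
  have h2 : DifferentiableAt ℂ (fun k : ℂ => hankelH n (k * r)) k :=
    DifferentiableAt.comp (f := fun k : ℂ => k * r) k h (by fun_prop)
  exact h2.const_mul _

theorem differentiableAt_freeFieldDeriv (n : ℕ) {k : ℂ} (hk : 0 < k.im) {r : ℝ} (hr : 0 < r) :
    DifferentiableAt ℂ (fun k => freeFieldDeriv n k r) k := by
  have h := (hasDerivAt_hankelH n (mul_ofReal_im_pos hk hr)).differentiableAt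
  have h2 : DifferentiableAt ℂ (fun k : ℂ => hankelH n (k * r)) k :=
    DifferentiableAt.comp (f := fun k : ℂ => k * r) k h (by fun_prop)
  have h' := (hasDerivAt_hankelDeriv n (mul_ofReal_im_pos hk hr)).differentiableAt
  have h3 : DifferentiableAt ℂ (fun k : ℂ => hankelDeriv n (k * r)) k :=
    DifferentiableAt.comp (f := fun k : ℂ => k * r) k h' (by fun_prop)
  exact (h2.const_mul _).add ((differentiableAt_id.mul h3).const_mul _)

/-! ### The radial equation: uniqueness, existence and dependence on the frequency. -/

/-- The radial equation as a first order system on `(c, ∞)`, with the outgoing condition. -/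
structure IsFieldSystem (q : ℝ → ℝ) (b : ℝ) (n : ℕ) (k : ℂ) (c : ℝ) (Y : ℝ → ℂ × ℂ) : Prop where
  hasDerivAt : ∀ r : ℝ, c < r → HasDerivAt Y
    ((Y r).2, (((n : ℂ) ^ 2 - 1 / 4) / (r : ℂ) ^ 2 - k ^ 2 * (1 + (q r : ℂ))) * (Y r).1) r
  fst_eq : ∀ r : ℝ, b ≤ r → (Y r).1 = freeField n k r
  snd_eq : ∀ r : ℝ, b < r → (Y r).2 = freeFieldDeriv n k r

theorem IsRadialField.isFieldSystem {q : ℝ → ℝ} {b : ℝ} (hb : 0 < b) {n : ℕ} {k : ℂ}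
    (hk : 0 < k.im) {ψ : ℝ → ℂ} (h : IsRadialField q b n k ψ) :
    IsFieldSystem q b n k 0 fun r => (ψ r, deriv ψ r) := by
  refine ⟨fun r hr => ?_, h.outgoing, fun r hr => ?_⟩
  · refine ((h.differentiableAt r hr).hasDerivAt.prodMk
      (h.differentiableAt_deriv r hr).hasDerivAt).congr_deriv ?_
    have := h.ode r hr
    congr 1
    linear_combination this
  · refine HasDerivAt.deriv ?_
    refine (hasDerivAt_freeField n hk (hb.trans hr)).congr_of_eventuallyEq ?_
    filter_upwards [Ioi_mem_nhds hr] with t ht using h.outgoing t (le_of_lt ht)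

theorem IsFieldSystem.isRadialField {q : ℝ → ℝ} {b : ℝ} {n : ℕ} {k : ℂ} {Y : ℝ → ℂ × ℂ}
    (h : IsFieldSystem q b n k 0 Y) : IsRadialField q b n k fun r => (Y r).1 := by
  have h1 : ∀ r : ℝ, 0 < r → HasDerivAt (fun r => (Y r).1) (Y r).2 r := fun r hr =>
    (hasFDerivAt_fst (𝕜 := ℝ) (p := Y r)).comp_hasDerivAt r (h.hasDerivAt r hr)
  have h2 : ∀ r : ℝ, 0 < r → HasDerivAt (deriv fun r => (Y r).1)
      ((((n : ℂ) ^ 2 - 1 / 4) / (r : ℂ) ^ 2 - k ^ 2 * (1 + (q r : ℂ))) * (Y r).1) r := by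
    intro r hr
    have h3 : HasDerivAt (fun r => (Y r).2) _ r :=
      (hasFDerivAt_snd (𝕜 := ℝ) (p := Y r)).comp_hasDerivAt r (h.hasDerivAt r hr)
    refine h3.congr_of_eventuallyEq ?_
    filter_upwards [Ioi_mem_nhds hr] with t ht using (h1 t ht).deriv
  exact ⟨fun r hr => (h1 r hr).differentiableAt, fun r hr => (h2 r hr).differentiableAt,
    fun r hr => by rw [(h2 r hr).deriv]; ring, h.fst_eq⟩

/-- The part of the coefficient matrix that does not depend on the frequency, frozen left
of `c`. -/
def fieldMatrix₀ (n : ℕ) (c t : ℝ) : ℂ × ℂ →L[ℂ] ℂ × ℂ :=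
  (ContinuousLinearMap.inl ℂ ℂ ℂ).comp (ContinuousLinearMap.snd ℂ ℂ ℂ) +
    (((n : ℂ) ^ 2 - 1 / 4) / ((max t c : ℝ) : ℂ) ^ 2) •
      (ContinuousLinearMap.inr ℂ ℂ ℂ).comp (ContinuousLinearMap.fst ℂ ℂ ℂ)

/-- The part of the coefficient matrix proportional to the squared frequency, frozen left
of `c`. -/
def fieldMatrix₁ (q : ℝ → ℝ) (c t : ℝ) : ℂ × ℂ →L[ℂ] ℂ × ℂ :=
  (-(1 + (q (max t c) : ℂ))) •
    (ContinuousLinearMap.inr ℂ ℂ ℂ).comp (ContinuousLinearMap.fst ℂ ℂ ℂ)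

/-- Freezing at `c > 0` avoids the singularity at the origin and gives the continuity on all of `ℝ`
that `exists_linear_ode_solution` asks for. -/
theorem continuous_fieldMatrix₀ (n : ℕ) {c : ℝ} (hc : 0 < c) : Continuous (fieldMatrix₀ n c) := by
  have h : Continuous fun t : ℝ => ((n : ℂ) ^ 2 - 1 / 4) / ((max t c : ℝ) : ℂ) ^ 2 := by
    refine continuous_const.div (by fun_prop) fun t => pow_ne_zero _ ?_
    exact_mod_cast (hc.trans_le (le_max_right t c)).ne'
  exact continuous_const.add (h.smul continuous_const)

theorem continuous_fieldMatrix₁ {q : ℝ → ℝ} (hq : ContinuousOn q (Ioi 0)) {c : ℝ} (hc : 0 < c) :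
    Continuous (fieldMatrix₁ q c) := by
  have h : Continuous fun t : ℝ => q (max t c) :=
    hq.comp_continuous (by fun_prop) fun t => hc.trans_le (le_max_right t c)
  have h' : Continuous fun t : ℝ => (-(1 + (q (max t c) : ℂ))) :=
    (continuous_const.add (Complex.continuous_ofReal.comp h)).neg
  exact h'.smul continuous_const

theorem fieldMatrix_apply (q : ℝ → ℝ) (n : ℕ) {c t : ℝ} (ht : c ≤ t) (μ : ℂ) (x : ℂ × ℂ) :
    fieldMatrix₀ n c t x + μ • fieldMatrix₁ q c t x =
      (x.2, (((n : ℂ) ^ 2 - 1 / 4) / (t : ℂ) ^ 2 - μ * (1 + (q t : ℂ))) * x.1) := by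
  rw [fieldMatrix₀, fieldMatrix₁, max_eq_left ht]
  ext
  · simp
  · simp; ring

theorem field_system_unique {q : ℝ → ℝ} (hq : ContinuousOn q (Ioi 0)) {n : ℕ} {k : ℂ} {c d : ℝ}
    (hc : 0 < c) {Y Z : ℝ → ℂ × ℂ}
    (hY : ∀ r ∈ Icc c d, HasDerivAt Y
      ((Y r).2, (((n : ℂ) ^ 2 - 1 / 4) / (r : ℂ) ^ 2 - k ^ 2 * (1 + (q r : ℂ))) * (Y r).1) r)
    (hZ : ∀ r ∈ Icc c d, HasDerivAt Z
      ((Z r).2, (((n : ℂ) ^ 2 - 1 / 4) / (r : ℂ) ^ 2 - k ^ 2 * (1 + (q r : ℂ))) * (Z r).1) r)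
    (hd : Y d = Z d) : EqOn Y Z (Icc c d) := by
  refine linear_ode_unique (A := fun t => fieldMatrix₀ n c t + k ^ 2 • fieldMatrix₁ q c t)
    ((continuous_fieldMatrix₀ n hc).add ((continuous_fieldMatrix₁ hq hc).const_smul (k ^ 2)))
    (fun t ht => (hY t ht).congr_deriv ?_) (fun t ht => (hZ t ht).congr_deriv ?_) hd
  · exact (fieldMatrix_apply q n ht.1 _ _).symm
  · exact (fieldMatrix_apply q n ht.1 _ _).symm

/-- Both solutions carry the free data at a point `d` beyond `b` and `r`. Distinct `c` and `c'` are
allowed so that solutions on different half-lines can be glued. -/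
theorem IsFieldSystem.eq {q : ℝ → ℝ} (hq : ContinuousOn q (Ioi 0)) {b : ℝ} {n : ℕ} {k : ℂ}
    {c c' : ℝ} {Y Z : ℝ → ℂ × ℂ} (hY : IsFieldSystem q b n k c Y)
    (hZ : IsFieldSystem q b n k c' Z) {r : ℝ} (hr0 : 0 < r) (hr : c < r) (hr' : c' < r) :
    Y r = Z r := by
  set d : ℝ := max b r + 1
  have hbd : b < d := by have := le_max_left b r; simp only [d]; linarith
  have hrd : r < d := by have := le_max_right b r; simp only [d]; linarith
  refine field_system_unique hq (n := n) (k := k) hr0 (d := d)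
    (fun t ht => hY.hasDerivAt t (hr.trans_le ht.1))
    (fun t ht => hZ.hasDerivAt t (hr'.trans_le ht.1)) ?_ ⟨le_rfl, hrd.le⟩
  ext1
  · rw [hY.fst_eq d hbd.le, hZ.fst_eq d hbd.le]
  · rw [hY.snd_eq d hbd, hZ.snd_eq d hbd]

theorem hasDerivAt_free_system (n : ℕ) {k : ℂ} (hk : 0 < k.im) {r : ℝ} (hr : 0 < r) {q : ℝ → ℝ}
    (hq : q r = 0) : HasDerivAt (fun r => (freeField n k r, freeFieldDeriv n k r))
      (freeFieldDeriv n k r,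
        (((n : ℂ) ^ 2 - 1 / 4) / (r : ℂ) ^ 2 - k ^ 2 * (1 + (q r : ℂ))) * freeField n k r) r := by
  refine ((hasDerivAt_freeField n hk hr).prodMk
    (hasDerivAt_freeFieldDeriv n hk hr)).congr_deriv ?_
  rw [hq]
  simp

theorem exists_isFieldSystem_of_pos {q : ℝ → ℝ} (hq : ContinuousOn q (Ioi 0)) {b : ℝ}
    (hqb : ∀ r, b ≤ r → q r = 0) (n : ℕ) {k : ℂ} (hk : 0 < k.im) {c : ℝ} (hc : 0 < c)
    (hcb : c < b) : ∃ Y, IsFieldSystem q b n k c Y := by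
  obtain ⟨Φ, hΦ, -⟩ := exists_linear_ode_solution (show c ≤ b + 1 by linarith)
    (continuous_fieldMatrix₀ n hc) (continuous_fieldMatrix₁ hq hc) (‖k ^ 2‖ + 1)
  set F : ℝ → ℂ × ℂ := fun r => (freeField n k r, freeFieldDeriv n k r)
  obtain ⟨hZd, hZ⟩ := hΦ (k ^ 2) (by linarith) (F (b + 1))
  set Z := Φ (k ^ 2) (F (b + 1))
  have hZ' : ∀ r ∈ Icc c (b + 1), HasDerivAt Z
      ((Z r).2, (((n : ℂ) ^ 2 - 1 / 4) / (r : ℂ) ^ 2 - k ^ 2 * (1 + (q r : ℂ))) * (Z r).1) r :=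
    fun r hr => (hZ r hr).congr_deriv (fieldMatrix_apply q n hr.1 _ _)
  have hF : ∀ r, b ≤ r → HasDerivAt F
      ((F r).2, (((n : ℂ) ^ 2 - 1 / 4) / (r : ℂ) ^ 2 - k ^ 2 * (1 + (q r : ℂ))) * (F r).1) r :=
    fun r hr => hasDerivAt_free_system n hk (hc.trans (hcb.trans_le hr)) (hqb r hr)
  -- Starting from `b + 1` rather than `b` leaves an overlap on which both formulas agree, so the
  -- glued function is differentiable at `b`.
  have hZF : EqOn Z F (Icc b (b + 1)) :=
    field_system_unique hq (n := n) (k := k) (hc.trans hcb)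
      (fun t ht => hZ' t ⟨hcb.le.trans ht.1, ht.2⟩) (fun t ht => hF t ht.1) hZd
  set Y : ℝ → ℂ × ℂ := fun r => if r < b then Z r else F r
  have hYF : ∀ r, b ≤ r → Y r = F r := fun r hr => if_neg (not_lt.2 hr)
  have hYZ : ∀ r, r ≤ b + 1 → Y r = Z r := by
    intro r hr
    rcases lt_or_ge r b with h | h
    · exact if_pos h
    · rw [hYF r h, hZF ⟨h, hr⟩]
  refine ⟨Y, fun r hr => ?_, fun r hr => by rw [hYF r hr], fun r hr => by rw [hYF r hr.le]⟩
  rcases lt_or_ge b r with h | h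
  · rw [hYF r h.le]
    refine (hF r h.le).congr_of_eventuallyEq ?_
    filter_upwards [Ioi_mem_nhds h] with t ht using hYF t (le_of_lt ht)
  · rw [hYZ r (by linarith)]
    refine (hZ' r ⟨hr.le, by linarith⟩).congr_of_eventuallyEq ?_
    filter_upwards [Iio_mem_nhds (show r < b + 1 by linarith)] with t ht using hYZ t (le_of_lt ht)

theorem exists_isFieldSystem {q : ℝ → ℝ} (hq : ContinuousOn q (Ioi 0)) {b : ℝ} (hb : 0 < b)
    (hqb : ∀ r, b ≤ r → q r = 0) (n : ℕ) {k : ℂ} (hk : 0 < k.im) :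
    ∃ Y, IsFieldSystem q b n k 0 Y := by
  have hex : ∀ c : ℝ, 0 < c → ∃ Y, IsFieldSystem q b n k (min c (b / 2)) Y := fun c hc =>
    exists_isFieldSystem_of_pos hq hqb n hk (lt_min hc (by linarith))
      ((min_le_right _ _).trans_lt (by linarith))
  choose! Y hY using hex
  have heq : ∀ c r : ℝ, 0 < c → c < r → Y (r / 2) r = Y c r := by
    intro c r hc hcr
    have hr : 0 < r := hc.trans hcr
    exact (hY (r / 2) (half_pos hr)).eq hq (hY c hc) hr
      ((min_le_left _ _).trans_lt (by linarith)) ((min_le_left _ _).trans_lt hcr)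
  -- At radius `r` any solution on a half-line reaching below `r` gives the same value; `r / 2` is
  -- one such choice.
  refine ⟨fun r => Y (r / 2) r, fun r hr => ?_,
    fun r hr => (hY (r / 2) (half_pos (hb.trans_le hr))).fst_eq r hr,
    fun r hr => (hY (r / 2) (half_pos (hb.trans hr))).snd_eq r hr⟩
  refine ((hY (r / 2) (half_pos hr)).hasDerivAt r
    ((min_le_left _ _).trans_lt (by linarith))).congr_of_eventuallyEq ?_
  filter_upwards [Ioi_mem_nhds (show r / 2 < r by linarith)] with t ht
  exact heq (r / 2) t (half_pos hr) ht

/-- The field and its radial derivative depend holomorphically on the frequency. -/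
theorem differentiableAt_field {q : ℝ → ℝ} (hq : ContinuousOn q (Ioi 0)) {b : ℝ} (hb : 0 < b)
    {n : ℕ} {Y : ℂ → ℝ → ℂ × ℂ} (hY : ∀ k : ℂ, 0 < k.im → IsFieldSystem q b n k 0 (Y k))
    {r : ℝ} (hr : 0 < r) {k : ℂ} (hk : 0 < k.im) : DifferentiableAt ℂ (fun k => Y k r) k := by
  set d : ℝ := max b r + 1
  have hbd : b < d := by have := le_max_left b r; simp only [d]; linarith
  have hrd : r < d := by have := le_max_right b r; simp only [d]; linarith
  obtain ⟨Φ, hΦ, hd⟩ := exists_linear_ode_solution hrd.le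
    (continuous_fieldMatrix₀ n hr) (continuous_fieldMatrix₁ hq hr) (‖k ^ 2‖ + 1)
  have h := hd (fun k => k ^ 2) (fun k => (freeField n k d, freeFieldDeriv n k d)) k
    (by linarith) (by fun_prop) ((differentiableAt_freeField n hk (hb.trans hbd)).prodMk
      (differentiableAt_freeFieldDeriv n hk (hb.trans hbd))) r ⟨le_rfl, hrd.le⟩
  refine h.congr_of_eventuallyEq ?_
  have hnear : ∀ᶠ k' in 𝓝 k, ‖k' ^ 2‖ < ‖k ^ 2‖ + 1 :=
    ((continuous_pow 2).norm.continuousAt).eventually_lt continuousAt_const (by simp)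
  filter_upwards [hnear, isOpen_upperHalfPlane.mem_nhds hk] with k' hk' him
  obtain ⟨hZd, hZ⟩ := hΦ (k' ^ 2) hk' (freeField n k' d, freeFieldDeriv n k' d)
  refine field_system_unique hq (n := n) (k := k') hr
    (fun t ht => (hY k' him).hasDerivAt t (hr.trans_le ht.1))
    (fun t ht => (hZ t ht).congr_deriv (fieldMatrix_apply q n ht.1 _ _)) ?_ ⟨le_rfl, hrd.le⟩
  rw [hZd]
  ext1
  · exact (hY k' him).fst_eq d hbd.le
  · exact (hY k' him).snd_eq d hbd

/-! ### The energy flux and the absence of zeros. -/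

/-- The energy flux `Re (i k̄ r u' ū)` of `ψ = √r u`. -/
def energyFlux (k : ℂ) (Y : ℝ → ℂ × ℂ) (r : ℝ) : ℝ :=
  (I * conj k * (((Y r).2 - (Y r).1 / (2 * r)) * conj (Y r).1)).re

theorem hasDerivAt_energyFlux {q : ℝ → ℝ} {b : ℝ} {n : ℕ} {k : ℂ} {Y : ℝ → ℂ × ℂ}
    (h : IsFieldSystem q b n k 0 Y) {r : ℝ} (hr : 0 < r) :
    HasDerivAt (energyFlux k Y) (k.im * (‖(Y r).2 - (Y r).1 / (2 * r)‖ ^ 2 +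
      ((n : ℝ) ^ 2 / r ^ 2 + ‖k‖ ^ 2 * (1 + q r)) * ‖(Y r).1‖ ^ 2)) r := by
  have hr0 : (r : ℂ) ≠ 0 := by exact_mod_cast hr.ne'
  have h1 : HasDerivAt (fun r => (Y r).1) (Y r).2 r :=
    (hasFDerivAt_fst (𝕜 := ℝ) (p := Y r)).comp_hasDerivAt r (h.hasDerivAt r hr)
  have h2 : HasDerivAt (fun r => (Y r).2) _ r :=
    (hasFDerivAt_snd (𝕜 := ℝ) (p := Y r)).comp_hasDerivAt r (h.hasDerivAt r hr)
  have h3 : HasDerivAt (fun r : ℝ => 2 * (r : ℂ)) 2 r := by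
    simpa using (hasDerivAt_id r).ofReal_comp.const_mul (2 : ℂ)
  have hv := h2.sub (h1.div h3 (mul_ne_zero two_ne_zero hr0))
  have hP := (hv.mul h1.star).const_mul (I * conj k)
  have hre := Complex.reCLM.hasFDerivAt.comp_hasDerivAt r hP
  have hF : HasDerivAt (energyFlux k Y) _ r := hre
  refine hF.congr_deriv ?_
  set x := (Y r).1
  set y := (Y r).2
  simp only [Pi.sub_apply, Pi.div_apply, ContinuousLinearMap.coe_snd', Complex.reCLM_apply,
    ← starRingEnd_apply]
  set v : ℂ := y - x / (2 * r)
  have hy : y = v + x / (2 * r) := by simp [v]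
  have hcr : conj (2 * (r : ℂ)) = 2 * r := by rw [map_mul, Complex.conj_ofReal, map_ofNat]
  have hc : conj y = conj v + conj x / (2 * r) := by
    rw [hy, map_add, map_div₀, hcr]
  have hvv : v * conj v = ((‖v‖ ^ 2 : ℝ) : ℂ) := by rw [Complex.mul_conj']; push_cast; rfl
  have hxx : x * conj x = ((‖x‖ ^ 2 : ℝ) : ℂ) := by rw [Complex.mul_conj']; push_cast; rfl
  have hkk : k * conj k = ((‖k‖ ^ 2 : ℝ) : ℂ) := by rw [Complex.mul_conj']; push_cast; rfl
  -- In terms of `v = √r u'` the `-1/4` disappears.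
  have e : ((((n : ℂ) ^ 2 - 1 / 4) / (r : ℂ) ^ 2 - k ^ 2 * (1 + (q r : ℂ))) * x -
        (y * (2 * r) - x * 2) / (2 * (r : ℂ)) ^ 2) * conj x + v * conj y =
      v * conj v + ((n : ℂ) ^ 2 / r ^ 2 - k ^ 2 * (1 + (q r : ℂ))) * (x * conj x) := by
    rw [hc, hy]
    field_simp
    ring
  -- Since `k̄ k² = |k|² k`, the coefficients become `i k̄` and `-i k`, both of real part `Im k`;
  -- this is why the flux contains `k̄`.
  have e2 : I * conj k * (v * conj v + ((n : ℂ) ^ 2 / r ^ 2 - k ^ 2 * (1 + (q r : ℂ))) *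
        (x * conj x)) =
      (I * conj k) * (((‖v‖ ^ 2 + (n : ℝ) ^ 2 / r ^ 2 * ‖x‖ ^ 2 : ℝ)) : ℂ) -
        (I * k) * ((‖k‖ ^ 2 * (1 + q r) * ‖x‖ ^ 2 : ℝ) : ℂ) := by
    rw [hvv, hxx]
    push_cast at hkk ⊢
    linear_combination -(I * k * (1 + (q r : ℂ)) * (‖x‖ : ℂ) ^ 2) * hkk
  rw [e, e2, Complex.sub_re, Complex.re_mul_ofReal, Complex.re_mul_ofReal]
  simp only [Complex.mul_re, I_re, I_im, Complex.conj_re, Complex.conj_im]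
  ring

theorem tendsto_energyFlux {q : ℝ → ℝ} {b : ℝ} (hb : 0 < b) {n : ℕ} {k : ℂ} (hk : 0 < k.im)
    {Y : ℝ → ℂ × ℂ} (h : IsFieldSystem q b n k 0 Y) :
    Tendsto (energyFlux k Y) atTop (𝓝 0) := by
  obtain ⟨C, hC⟩ := exists_norm_hankelH_le n
  have hlim : Tendsto (fun r : ℝ => ‖k‖ ^ 2 * ((n + 1) * C * C) / k.im *
      ((k.im * r) ^ 1 * Real.exp (-(k.im * r)))) atTop (𝓝 0) := by
    have h1 : Tendsto (fun r : ℝ => k.im * r) atTop atTop := tendsto_id.const_mul_atTop hk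
    have h2 := ((Real.tendsto_pow_mul_exp_neg_atTop_nhds_zero 1).comp h1).const_mul
      (‖k‖ ^ 2 * ((n + 1) * C * C) / k.im)
    rw [mul_zero] at h2
    exact h2
  refine squeeze_zero_norm' ?_ hlim
  filter_upwards [eventually_gt_atTop b, eventually_ge_atTop (1 / k.im)] with r hr hr1
  have hr0 : 0 < r := hb.trans hr
  have hrk : 1 ≤ k.im * r := by rwa [div_le_iff₀' hk] at hr1
  have him : (k * (r : ℂ)).im = k.im * r := by simp
  obtain ⟨hH, hH1⟩ := hC (k * r) (by rwa [him])
  have hz1 : 1 ≤ ‖k * (r : ℂ)‖ :=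
    (by rwa [him] : 1 ≤ (k * (r : ℂ)).im).trans
      ((le_abs_self _).trans (Complex.abs_im_le_norm _))
  rw [him] at hH hH1
  set w : ℝ := Real.exp (-(k.im * r))
  have hw0 : 0 < w := Real.exp_pos _
  have hw1 : w ≤ 1 := Real.exp_le_one_iff.2 (by linarith)
  have hCw : 0 ≤ C * w := (norm_nonneg _).trans hH
  have hC0 : 0 ≤ C := by
    by_contra hneg
    nlinarith
  have hD : ‖hankelDeriv n (k * r)‖ ≤ (n + 1) * (C * w) := by
    rw [hankelDeriv]
    refine (norm_sub_le _ _).trans ?_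
    rw [norm_mul, norm_div, Complex.norm_natCast]
    have : (n : ℝ) / ‖k * (r : ℂ)‖ ≤ n := div_le_self (Nat.cast_nonneg n) hz1
    have h3 : (n : ℝ) / ‖k * (r : ℂ)‖ * ‖hankelH n (k * r)‖ ≤ n * (C * w) := by gcongr
    linarith
  have hs0 : (Real.sqrt r : ℂ) ≠ 0 := by exact_mod_cast (Real.sqrt_pos.2 hr0).ne'
  have hrs : (r : ℂ) = (Real.sqrt r : ℂ) * Real.sqrt r := (ofReal_sqrt_mul_self hr0).symm
  have hv : (Y r).2 - (Y r).1 / (2 * r) = Real.sqrt r * (k * hankelDeriv n (k * r)) := by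
    rw [h.fst_eq r hr.le, h.snd_eq r hr, freeField, freeFieldDeriv]
    generalize hankelH n (k * r) = H₀
    generalize hankelDeriv n (k * r) = H₁
    rw [hrs]
    field_simp
    ring
  have hsr : Real.sqrt r * Real.sqrt r = r := Real.mul_self_sqrt hr0.le
  rw [energyFlux, Real.norm_eq_abs]
  refine (Complex.abs_re_le_norm _).trans ?_
  rw [hv, h.fst_eq r hr.le, freeField]
  simp only [norm_mul, Complex.norm_conj, norm_I, one_mul, Complex.norm_real,
    Real.norm_of_nonneg (Real.sqrt_nonneg r)]
  calc ‖k‖ * (Real.sqrt r * (‖k‖ * ‖hankelDeriv n (k * r)‖) *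
        (Real.sqrt r * ‖hankelH n (k * r)‖))
      = ‖k‖ ^ 2 * (Real.sqrt r * Real.sqrt r) *
          (‖hankelDeriv n (k * r)‖ * ‖hankelH n (k * r)‖) := by ring
    _ ≤ ‖k‖ ^ 2 * r * ((n + 1) * (C * w) * (C * w)) := by rw [hsr]; gcongr
    _ = ‖k‖ ^ 2 * ((n + 1) * C * C) * r * w * w := by ring
    -- One of the two exponentials is enough to beat the factor `r`.
    _ ≤ ‖k‖ ^ 2 * ((n + 1) * C * C) * r * w * 1 := by gcongr
    _ = _ := by field_simp

/-- The radial field has no zeros. -/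
theorem IsFieldSystem.fst_ne_zero {q : ℝ → ℝ} (hq1 : ∀ r, 0 < r → -1 < q r) {b : ℝ} (hb : 0 < b)
    {n : ℕ} {k : ℂ} (hk : 0 < k.im) {Y : ℝ → ℂ × ℂ} (h : IsFieldSystem q b n k 0 Y) {r₀ : ℝ}
    (hr₀ : 0 < r₀) : (Y r₀).1 ≠ 0 := by
  intro h0
  have hk0 : k ≠ 0 := by rintro rfl; simp at hk
  have hnn : ∀ r, 0 < r → 0 ≤ k.im * (‖(Y r).2 - (Y r).1 / (2 * r)‖ ^ 2 +
      ((n : ℝ) ^ 2 / r ^ 2 + ‖k‖ ^ 2 * (1 + q r)) * ‖(Y r).1‖ ^ 2) := by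
    intro r hr
    have : 0 < 1 + q r := by linarith [hq1 r hr]
    positivity
  have hmono : MonotoneOn (energyFlux k Y) (Ici r₀) := by
    refine monotoneOn_of_hasDerivWithinAt_nonneg (convex_Ici r₀)
      (fun r hr => (hasDerivAt_energyFlux h
        (hr₀.trans_le hr)).continuousAt.continuousWithinAt)
      (fun r hr => (hasDerivAt_energyFlux h ?_).hasDerivWithinAt) (fun r hr => hnn r ?_) <;>
    · rw [interior_Ici] at hr
      exact hr₀.trans hr
  have hF0 : energyFlux k Y r₀ = 0 := by rw [energyFlux, h0]; simp
  -- An increasing function that starts at `0` and tends to `0` is identically `0`.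
  have hzero : ∀ r, r₀ ≤ r → energyFlux k Y r = 0 := by
    intro r hr
    refine le_antisymm (ge_of_tendsto (tendsto_energyFlux hb hk h) ?_) ?_
    · filter_upwards [eventually_ge_atTop r] with s hs using hmono hr (hr.trans hs) hs
    · rw [← hF0]
      exact hmono self_mem_Ici hr hr
  have hvan : ∀ r, r₀ < r → (Y r).1 = 0 := by
    intro r hr
    have hr0 : 0 < r := hr₀.trans hr
    have h1 : HasDerivAt (energyFlux k Y) 0 r := by
      refine (hasDerivAt_const r (0 : ℝ)).congr_of_eventuallyEq ?_
      filter_upwards [Ioi_mem_nhds hr] with t ht using hzero t (le_of_lt ht)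
    have h2 := (hasDerivAt_energyFlux h hr0).unique h1
    have h3 := (mul_eq_zero.1 h2).resolve_left hk.ne'
    have hq : 0 < 1 + q r := by linarith [hq1 r hr0]
    have hkn : 0 < ‖k‖ := norm_pos_iff.2 hk0
    have hco : 0 < (n : ℝ) ^ 2 / r ^ 2 + ‖k‖ ^ 2 * (1 + q r) := by positivity
    have h4 := (add_eq_zero_iff_of_nonneg (by positivity) (by positivity)).1 h3
    have h5 := (mul_eq_zero.1 h4.2).resolve_left hco.ne'
    simpa using h5
  refine hankelH_not_vanish_ray n hk (max r₀ b) fun r hr => ?_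
  have hrb : b < r := (le_max_right _ _).trans_lt hr
  have := hvan r ((le_max_left _ _).trans_lt hr)
  rw [h.fst_eq r hrb.le, freeField] at this
  refine (mul_eq_zero.1 this).resolve_left ?_
  exact_mod_cast (Real.sqrt_pos.2 (hb.trans hrb)).ne'

end

theorem mainTheorem5 (a b q₀ q₁ : ℝ) (ha : 0 < a) (hab : a < b)
    (hq₀ : -1 < q₀) (hq₀₁ : q₀ ≤ q₁)
    (q : ℝ → ℝ) (hq_cont : ContinuousOn q (Set.Ioi 0))
    (hq_mem : ∀ r : ℝ, 0 < r → q r ∈ Set.Icc q₀ q₁)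
    (hq_supp : ∀ r : ℝ, 0 < r → r ∉ Set.Icc a b → q r = 0)
    (n : ℕ) :
    -- the field exists and is unique for every `k` in the upper half-plane
    (∀ k : ℂ, 0 < k.im →
      ∃ ψ : ℝ → ℂ, IsRadialField q b n k ψ ∧
        ∀ χ : ℝ → ℂ, IsRadialField q b n k χ → Set.EqOn χ ψ (Set.Ioi 0)) ∧
    -- it has no zeros, and its impedance is analytic in `k`
    (∀ ψ : ℂ → ℝ → ℂ, (∀ k : ℂ, 0 < k.im → IsRadialField q b n k (ψ k)) →
      ∀ r : ℝ, 0 < r →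
        (∀ k : ℂ, 0 < k.im → ψ k r ≠ 0) ∧
        AnalyticOnNhd ℂ (fun k : ℂ => impedance (ψ k) r k) {k : ℂ | 0 < k.im}) := by
  have hb : 0 < b := ha.trans hab
  have hq1 : ∀ r, 0 < r → -1 < q r := fun r hr => hq₀.trans_le (hq_mem r hr).1
  have hqb' : ∀ r, b < r → q r = 0 := fun r hr =>
    hq_supp r (hb.trans hr) fun h => (not_lt.2 h.2) hr
  -- The support condition says nothing at `r = b` itself; there continuity from the right gives the
  -- value.
  have hqb : ∀ r, b ≤ r → q r = 0 := by
    intro r hr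
    rcases hr.eq_or_lt with rfl | h
    · have hc : ContinuousAt q b := hq_cont.continuousAt (Ioi_mem_nhds hb)
      refine tendsto_nhds_unique (hc.mono_left (nhdsWithin_le_nhds (s := Ioi b))) ?_
      refine tendsto_const_nhds.congr' ?_
      filter_upwards [self_mem_nhdsWithin] with r hr using (hqb' r hr).symm
    · exact hqb' r h
  refine ⟨fun k hk => ?_, fun ψ hψ r hr => ?_⟩
  · obtain ⟨Y, hY⟩ := exists_isFieldSystem hq_cont hb hqb n hk
    refine ⟨_, hY.isRadialField, fun χ hχ r hr => ?_⟩
    exact congrArg Prod.fst ((hχ.isFieldSystem hb hk).eq hq_cont hY hr hr hr)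
  · have hY : ∀ k : ℂ, 0 < k.im → IsFieldSystem q b n k 0 fun r => (ψ k r, deriv (ψ k) r) :=
      fun k hk => (hψ k hk).isFieldSystem hb hk
    have hne : ∀ k : ℂ, 0 < k.im → ψ k r ≠ 0 := fun k hk => (hY k hk).fst_ne_zero hq1 hb hk hr
    refine ⟨hne, DifferentiableOn.analyticOnNhd (fun k hk => ?_) isOpen_upperHalfPlane⟩
    have hk' : 0 < k.im := hk
    have hk0 : k ≠ 0 := by rintro rfl; simp at hk'
    have hd := differentiableAt_field hq_cont hb hY hr hk
    have h1 : DifferentiableAt ℂ (fun k => ψ k r) k := hd.fst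
    have h2 : DifferentiableAt ℂ (fun k => deriv (ψ k) r) k := hd.snd
    exact (h2.div ((differentiableAt_id.const_mul I).mul h1)
      (mul_ne_zero (mul_ne_zero I_ne_zero hk0) (hne k hk))).differentiableWithinAt
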